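/- **Conventions.** For positive integers $p,n$, let $\mathrm{Mat}(p)$ be the complex $p\times p$ matrices, $\mathrm{Herm}(p)$ the real vector space of Hermitian ones with inner product $\langle X,Y\rangle=\operatorname{tr}(XY)$ (whose norm is the Frobenius norm $\|\cdot\|_F$), and $\mathrm{PD}(p)$ the positive definite ones. A linear map $\Phi:\mathrm{Mat}(p)\to\mathrm{Mat}(n)$ is completely positive if $\Phi(X)=\sum_{k=1}^r A_kXA_k^\dagger$ for some $A_1,\dots,A_r\in\mathbb C^{n\times p}$; its dual $\Phi^*:\mathrm{Mat}(n)\to\mathrm{Mat}(p)$ is its adjoint for $\langle X,Y\rangle=\operatorname{tr}(X^\dagger Y)$, that is $\Phi^*(Y)=\sum_k A_k^\dagger YA_k$, and its size is $s(\Phi)=\operatorname{tr}\Phi(I_p)$. For $\lambda\in\mathbb R$, a completely positive map $\Phi$ is a $(1-\lambda)$-quantum expander if $\Phi(I_p)=\frac{s(\Phi)}{n}I_n$, $\Phi^*(I_n)=\frac{s(\Phi)}{p}I_p$ and $$\|\Phi(X)\|_F\le(1-\lambda)\frac{s(\Phi)}{\sqrt{np}}\,\|X\|_F\qquad\text{for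 all } X\in\mathrm{Herm}(p)\text{ with }\operatorname{tr}X=0 .$$ Let $f^\Phi(Z)=\frac pn\log\det\Phi(Z)-\log\det Z$ for $Z\in\mathrm{PD}(p)$, and for $f:\mathrm{PD}(p)\to\mathbb R$ let the geodesic gradient $\nabla f(Z)\in\mathrm{Herm}(p)$ be the gradient at $X=0$ of the function $X\mapsto f(\sqrt Z\,e^X\sqrt Z)$ on $\mathrm{Herm}(p)$. The Sinkhorn iterates starting at $Z_0\in\mathrm{PD}(p)$ are given by $Z_t^{-1}=\frac pn\Phi^*(\Phi(Z_{t-1})^{-1})$ for $t\ge1$. **Theorem.** There are absolute constants $c>0$ and $a>0$ such that the following holds for all $p,n\ge 1$, all $\lambda\ge0$, every nonzero $(1-\lambda)$-quantum expander $\Phi:\mathrm{Mat}(p)\to\mathrm{Mat}(n)$ and every $Z_0\in\mathrm{PD}(p)$. If $\|\nabla f^\Phi(Z_0)\|_F\le c\lambda^2$, then for every integer $T\ge0$ the $T$-th Sinkhorn iterate $Z_T$ starting at $Z_0$ is well defined and positive definite, $f^\Phi$ is differentiable there (in the sense that $X\mapsto f^\Phi(\sqrt{Z_T}\,e^X\sqrt{Z_T})$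 is differentiable at $X=0$), and $$\|\nabla f^\Phi(Z_T)\|_F\le\exp(-a\lambda T).$$ -/

import Mathlib

open scoped Matrix ComplexOrder

noncomputable section

namespace OperatorScaling

/-! Completely positive maps between complex matrix spaces -/

/-- `Φ : Mat(p) → Mat(n)` is completely positive: `Φ(X) = ∑ₖ Aₖ X Aₖ†` for some finite family of
`n × p` matrices `Aₖ`. -/
def IsCompletelyPositive {p n : ℕ}
    (Φ : Matrix (Fin p) (Fin p) ℂ →ₗ[ℂ] Matrix (Fin n) (Fin n) ℂ) : Prop :=
  ∃ (r : ℕ) (A : Fin r → Matrix (Fin n) (Fin p) ℂ), ∀ X, Φ X = ∑ k, A k * X * (A k)ᴴ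

/-- The size `s(Φ) = tr Φ(I_p)`. -/
def size {p n : ℕ} (Φ : Matrix (Fin p) (Fin p) ℂ →ₗ[ℂ] Matrix (Fin n) (Fin n) ℂ) : ℝ :=
  (Φ 1).trace.re

/-- The dual `Φ*` of `Φ`: its Hermitian adjoint for the inner product `⟨X, Y⟩ = tr(X† Y)`, written
out on the matrix units (see `trace_dual` for the adjunction). -/
def dual {p n : ℕ} (Φ : Matrix (Fin p) (Fin p) ℂ →ₗ[ℂ] Matrix (Fin n) (Fin n) ℂ) :
    Matrix (Fin n) (Fin n) ℂ →ₗ[ℂ] Matrix (Fin p) (Fin p) ℂ where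
  toFun Y := Matrix.of fun i j => ((Φ (Matrix.single i j 1))ᴴ * Y).trace
  map_add' Y Y' := by
    ext i j
    simp [Matrix.mul_add]
  map_smul' a Y := by
    ext i j
    simp

theorem trace_dual {p n : ℕ} (Φ : Matrix (Fin p) (Fin p) ℂ →ₗ[ℂ] Matrix (Fin n) (Fin n) ℂ)
    (X : Matrix (Fin p) (Fin p) ℂ) (Y : Matrix (Fin n) (Fin n) ℂ) :
    ((Φ X)ᴴ * Y).trace = (Xᴴ * dual Φ Y).trace := by
  have h : ∀ i j, Φ (Matrix.single i j (X i j)) = X i j • Φ (Matrix.single i j 1) := by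
    intro i j
    rw [← map_smul, Matrix.smul_single, smul_eq_mul, mul_one]
  conv_lhs => rw [Matrix.matrix_eq_sum_single X]
  simp only [map_sum, h, Matrix.conjTranspose_sum, Matrix.conjTranspose_smul, Matrix.sum_mul,
    Matrix.trace_sum, Matrix.smul_mul, Matrix.trace_smul]
  simp only [Matrix.trace, Matrix.diag_apply, Matrix.mul_apply (M := Xᴴ), dual, LinearMap.coe_mk,
    AddHom.coe_mk, Matrix.of_apply, Matrix.conjTranspose_apply, smul_eq_mul]
  rw [Finset.sum_comm]

/-- The Kraus form of the dual: `Φ*(Y) = ∑ₖ Aₖ† Y Aₖ`. -/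
theorem dual_eq_of_kraus {p n r : ℕ}
    (Φ : Matrix (Fin p) (Fin p) ℂ →ₗ[ℂ] Matrix (Fin n) (Fin n) ℂ)
    (A : Fin r → Matrix (Fin n) (Fin p) ℂ) (h : ∀ X, Φ X = ∑ k, A k * X * (A k)ᴴ)
    (Y : Matrix (Fin n) (Fin n) ℂ) : dual Φ Y = ∑ k, (A k)ᴴ * Y * A k := by
  ext i j
  have e : ∀ M : Matrix (Fin p) (Fin p) ℂ,
      ((Matrix.single i j (1 : ℂ))ᴴ * M).trace = M i j := by
    intro M
    simp [Matrix.conjTranspose_single, Matrix.trace_single_mul]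
  rw [← e (dual Φ Y), ← e (∑ k, (A k)ᴴ * Y * A k), ← trace_dual, h]
  simp only [Matrix.conjTranspose_sum, Matrix.conjTranspose_mul, Matrix.conjTranspose_conjTranspose,
    Matrix.sum_mul, Matrix.mul_sum, Matrix.trace_sum]
  refine Finset.sum_congr rfl fun k _ => ?_
  rw [Matrix.trace_mul_comm (Matrix.single i j (1 : ℂ))ᴴ]
  simp only [Matrix.mul_assoc]
  rw [← Matrix.mul_assoc (A k), Matrix.trace_mul_comm]
  simp only [Matrix.mul_assoc]

/-- The operator norm of a square complex matrix acting on Euclidean space. -/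
def opNorm {m : ℕ} (M : Matrix (Fin m) (Fin m) ℂ) : ℝ :=
  ‖Matrix.toEuclideanCLM (n := Fin m) (𝕜 := ℂ) M‖

/-- `Φ` is `ε`-doubly balanced. -/
def IsDoublyBalanced {p n : ℕ} (Φ : Matrix (Fin p) (Fin p) ℂ →ₗ[ℂ] Matrix (Fin n) (Fin n) ℂ)
    (ε : ℝ) : Prop :=
  opNorm (Φ 1 - (size Φ / n) • (1 : Matrix (Fin n) (Fin n) ℂ)) ≤ size Φ * ε / n ∧
  opNorm (dual Φ 1 - (size Φ / p) • (1 : Matrix (Fin p) (Fin p) ℂ)) ≤ size Φ * ε / p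

open scoped Matrix.Norms.Frobenius in
/-- `Φ` is an `(ε, q)`-quantum expander: it is completely positive, `ε`-doubly balanced and
`‖Φ(X)‖_F ≤ q (s(Φ) / √(np)) ‖X‖_F` for all traceless Hermitian `X`. Here `‖·‖` is the Frobenius
norm. -/
def IsApproxQuantumExpander {p n : ℕ}
    (Φ : Matrix (Fin p) (Fin p) ℂ →ₗ[ℂ] Matrix (Fin n) (Fin n) ℂ) (ε q : ℝ) : Prop :=
  IsCompletelyPositive Φ ∧ IsDoublyBalanced Φ ε ∧
    ∀ X : Matrix (Fin p) (Fin p) ℂ, X.IsHermitian → X.trace = 0 →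
      ‖Φ X‖ ≤ q * (size Φ / Real.sqrt (n * p)) * ‖X‖

/-- A `q`-quantum expander is a `(0, q)`-quantum expander. -/
def IsQuantumExpander {p n : ℕ}
    (Φ : Matrix (Fin p) (Fin p) ℂ →ₗ[ℂ] Matrix (Fin n) (Fin n) ℂ) (q : ℝ) : Prop :=
  IsApproxQuantumExpander Φ 0 q

/-- The Sinkhorn iterates starting at `Z₀`:
`Z_t⁻¹ = (p / n) Φ*(Φ(Z_{t-1})⁻¹)`. -/
def sinkhorn {p n : ℕ} (Φ : Matrix (Fin p) (Fin p) ℂ →ₗ[ℂ] Matrix (Fin n) (Fin n) ℂ)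
    (Z₀ : Matrix (Fin p) (Fin p) ℂ) : ℕ → Matrix (Fin p) (Fin p) ℂ
  | 0 => Z₀
  | t + 1 => (((p : ℝ) / n) • dual Φ (Φ (sinkhorn Φ Z₀ t))⁻¹)⁻¹

/-- The function `f^Φ(Z) = (p / n) log det Φ(Z) - log det Z` (meaningful for positive definite `Z`,
where both determinants are positive reals as soon as `Φ(Z)` is positive definite). -/
def capacityFun {p n : ℕ} (Φ : Matrix (Fin p) (Fin p) ℂ →ₗ[ℂ] Matrix (Fin n) (Fin n) ℂ)
    (Z : Matrix (Fin p) (Fin p) ℂ) : ℝ :=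
  ((p : ℝ) / n) * Real.log (Φ Z).det.re - Real.log Z.det.re

/-! The geodesic gradient -/

/-- `Herm(p)`: the real vector space of Hermitian `p × p` matrices. It is not reducible, so that its
only norm is the one of the trace inner product below. -/
def Herm (p : ℕ) : Type := selfAdjoint.submodule ℝ (Matrix (Fin p) (Fin p) ℂ)

instance Herm.instAddCommGroup (p : ℕ) : AddCommGroup (Herm p) :=
  inferInstanceAs (AddCommGroup (selfAdjoint.submodule ℝ (Matrix (Fin p) (Fin p) ℂ)))

instance Herm.instModule (p : ℕ) : Module ℝ (Herm p) :=
  inferInstanceAs (Module ℝ (selfAdjoint.submodule ℝ (Matrix (Fin p) (Fin p) ℂ)))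

instance Herm.instFiniteDimensional (p : ℕ) : FiniteDimensional ℝ (Herm p) :=
  inferInstanceAs (FiniteDimensional ℝ (selfAdjoint.submodule ℝ (Matrix (Fin p) (Fin p) ℂ)))

/-- The inclusion of `Herm(p)` into `Mat(p)`. -/
def Herm.toMat {p : ℕ} : Herm p →ₗ[ℝ] Matrix (Fin p) (Fin p) ℂ :=
  (selfAdjoint.submodule ℝ (Matrix (Fin p) (Fin p) ℂ)).subtype

theorem Herm.toMat_injective {p : ℕ} : Function.Injective (Herm.toMat (p := p)) :=
  Subtype.val_injective

theorem Herm.isHermitian_toMat {p : ℕ} (X : Herm p) : X.toMat.IsHermitian := X.2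

theorem Herm.exists_toMat_eq {p : ℕ} {M : Matrix (Fin p) (Fin p) ℂ} (hM : M.IsHermitian) :
    ∃ X : Herm p, X.toMat = M := ⟨⟨M, hM⟩, rfl⟩

open scoped Matrix.Norms.Frobenius in
theorem frobenius_sq {p : ℕ} (M : Matrix (Fin p) (Fin p) ℂ) :
    (Mᴴ * M).trace.re = ‖M‖ ^ 2 := by
  rw [Matrix.frobenius_norm_def, ← Real.sqrt_eq_rpow, Real.sq_sqrt (by positivity),
    Finset.sum_comm]
  simp [Matrix.trace, Matrix.mul_apply, Complex.sq_norm, Complex.normSq_apply]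

open scoped Matrix.Norms.Frobenius in
/-- The trace inner product `⟨X, Y⟩ = tr(X† Y) = tr(X Y)` on `Herm(p)`. -/
abbrev Herm.innerCore (p : ℕ) : InnerProductSpace.Core ℝ (Herm p) where
  inner X Y := (X.toMatᴴ * Y.toMat).trace.re
  conj_inner_symm X Y := by
    simp only [conj_trivial]
    rw [← Complex.conj_re, ← RCLike.star_def, ← Matrix.trace_conjTranspose]
    simp
  re_inner_nonneg X := by
    simp only [frobenius_sq, RCLike.re_to_real]
    positivity
  add_left X Y Z := by simp [Matrix.add_mul]
  smul_left X Y a := by simp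
  definite X h := by
    apply Herm.toMat_injective
    simpa [frobenius_sq] using h

instance Herm.instNormedAddCommGroup (p : ℕ) : NormedAddCommGroup (Herm p) :=
  (Herm.innerCore p).toNormedAddCommGroup

instance Herm.instInnerProductSpace (p : ℕ) : InnerProductSpace ℝ (Herm p) :=
  InnerProductSpace.ofCore (Herm.innerCore p).toCore

instance Herm.instCompleteSpace (p : ℕ) : CompleteSpace (Herm p) :=
  FiniteDimensional.complete ℝ _

theorem Herm.inner_def {p : ℕ} (X Y : Herm p) :
    inner ℝ X Y = (X.toMatᴴ * Y.toMat).trace.re := rfl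

open scoped Matrix.Norms.Frobenius in
/-- The norm on `Herm(p)` is the Frobenius norm. -/
theorem Herm.norm_eq_frobenius {p : ℕ} (X : Herm p) : ‖X‖ = ‖X.toMat‖ := by
  rw [← sq_eq_sq₀ (norm_nonneg _) (norm_nonneg _), ← frobenius_sq, ← Herm.inner_def,
    real_inner_self_eq_norm_sq]

open scoped MatrixOrder in
/-- The geodesic coordinates `X ↦ √Z e^X √Z` of positive definite matrices around `Z`. -/
def geodesicCoord {p : ℕ} (Z : Matrix (Fin p) (Fin p) ℂ) (X : Herm p) :
    Matrix (Fin p) (Fin p) ℂ :=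
  CFC.sqrt Z * NormedSpace.exp X.toMat * CFC.sqrt Z

/-- The geodesic gradient `∇f(Z) = ∇_X f(√Z e^X √Z)|_{X = 0}`, a Hermitian matrix; the gradient is
taken with respect to the trace inner product on `Herm(p)`. -/
def geodesicGradient {p : ℕ} (f : Matrix (Fin p) (Fin p) ℂ → ℝ) (Z : Matrix (Fin p) (Fin p) ℂ) :
    Herm p :=
  gradient (fun X : Herm p => f (geodesicCoord Z X)) 0

/-- `f` is differentiable at `Z`, in geodesic coordinates; `geodesicGradient f Z` is then its
actual gradient. -/
def GeodesicallyDifferentiableAt {p : ℕ} (f : Matrix (Fin p) (Fin p) ℂ → ℝ)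
    (Z : Matrix (Fin p) (Fin p) ℂ) : Prop :=
  DifferentiableAt ℝ (fun X : Herm p => f (geodesicCoord Z X)) 0

end OperatorScaling

end

/-! Rescale `Φ` and `Φ*` to positive unital maps `Φ'`, `Ψ`, adjoint up to `κ = p/n`. The gradient
becomes `√Z Ψ(Φ'(Z)⁻¹) √Z - 1`, the Sinkhorn step becomes `Z ↦ (Ψ(Φ'(Z)⁻¹))⁻¹`, and the expander
bound says that `√κ Φ'` contracts traceless Hermitian matrices by `1 - λ`.

Localization (`exists_opWithin_of_norm_gradient_lt`): scale `Z` to `e^W` with `W` traceless. Along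
`e^{tW}` the function `f` is convex with slope zero at `t = 0`. Its second derivative there is `κ
tr(Φ'(W²) - Φ'(W)²) ≥ λ‖W‖²`, and it loses at most a factor `e^{-2d}` while the spectrum of `tW`
stays in `[-d, d]`. If `W` leaves that range, the slope at `t = 1`, which is `⟨∇f(Z), W⟩`, is at
least `dλe^{-2d}‖W‖`. A gradient of norm below `dλe^{-2d}` thus confines `Z` to within a factor
`e^d` of a scalar. Taking `d` of order `λ` explains the threshold of order `λ²`.

Contraction (`norm_gradient_step_le`): near the identity a step changes `Z` by `-G` to first order,
where `G` is the gradient, and the new gradient is approximately `ΨΦ'(G)`. Since `G` is traceless,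
`Φ'` gains `1 - λ`, while `Ψ` has norm at most `√κ`. Multiplicative errors are powers of `q = e^d`,
and `d = λ/80` leaves a factor at most `e^{-λ/2}`. The gradient therefore stays below the threshold
and the estimate iterates. -/

namespace OperatorScaling

/-! ### Loewner order: spectral bounds for inverses and square roots. -/

section PositiveSemidefinite

variable {m : ℕ}

theorem posSemidef_real_smul {A : Matrix (Fin m) (Fin m) ℂ} (hA : A.PosSemidef) {a : ℝ}
    (ha : 0 ≤ a) : (a • A).PosSemidef := by
  have := hA.smul (α := ℂ) (a := (a : ℂ)) (by exact_mod_cast ha)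
  rwa [Complex.coe_smul] at this

theorem posDef_real_smul {A : Matrix (Fin m) (Fin m) ℂ} (hA : A.PosDef) {a : ℝ}
    (ha : 0 < a) : (a • A).PosDef := by
  have := hA.smul (α := ℂ) (a := (a : ℂ)) (by exact_mod_cast ha)
  rwa [Complex.coe_smul] at this

theorem isHermitian_real_smul {A : Matrix (Fin m) (Fin m) ℂ} (hA : A.IsHermitian) (a : ℝ) :
    (a • A).IsHermitian := by
  rw [Matrix.IsHermitian, Matrix.conjTranspose_smul, hA.eq, star_trivial]

theorem isHermitian_real_smul_one (a : ℝ) :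
    (a • (1 : Matrix (Fin m) (Fin m) ℂ)).IsHermitian :=
  isHermitian_real_smul Matrix.isHermitian_one a

theorem posSemidef_conj_hermitian {A B : Matrix (Fin m) (Fin m) ℂ} (hA : A.PosSemidef)
    (hB : B.IsHermitian) : (B * A * B).PosSemidef := by
  have := hA.conjTranspose_mul_mul_same B
  rwa [hB.eq] at this

theorem trace_mul_re_nonneg {A B : Matrix (Fin m) (Fin m) ℂ} (hA : A.PosSemidef)
    (hB : B.PosSemidef) : 0 ≤ (A * B).trace.re := by
  obtain ⟨C, rfl⟩ : ∃ C : Matrix (Fin m) (Fin m) ℂ, A = Cᴴ * C := by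
    open scoped MatrixOrder in
    exact ⟨CFC.sqrt A, by
      rw [(Matrix.nonneg_iff_posSemidef.1 (CFC.sqrt_nonneg A)).1.eq, CFC.sqrt_mul_sqrt_self A hA.nonneg]⟩
  rw [Matrix.mul_assoc, Matrix.trace_mul_comm]
  exact (Complex.nonneg_iff.1 (hB.mul_mul_conjTranspose_same C).trace_nonneg).1

theorem trace_re_nonneg {A : Matrix (Fin m) (Fin m) ℂ} (hA : A.PosSemidef) : 0 ≤ A.trace.re :=
  (Complex.nonneg_iff.1 hA.trace_nonneg).1

/-- `OpWithin a b A`: the Hermitian matrix `A` has its spectrum in `[a, b]`. -/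
structure OpWithin (a b : ℝ) (A : Matrix (Fin m) (Fin m) ℂ) : Prop where
  left : (A - a • (1 : Matrix (Fin m) (Fin m) ℂ)).PosSemidef
  right : (b • (1 : Matrix (Fin m) (Fin m) ℂ) - A).PosSemidef

theorem posDef_of_sub_smul_one {a : ℝ} (ha : 0 < a) {A : Matrix (Fin m) (Fin m) ℂ}
    (h : (A - a • (1 : Matrix (Fin m) (Fin m) ℂ)).PosSemidef) : A.PosDef := by
  have := (posDef_real_smul (Matrix.PosDef.one (n := Fin m) (R := ℂ)) ha).add_posSemidef h
  simpa using this

theorem OpWithin.posDef {a b : ℝ} (ha : 0 < a) {A : Matrix (Fin m) (Fin m) ℂ}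
    (h : OpWithin a b A) : A.PosDef := posDef_of_sub_smul_one ha h.left

theorem OpWithin.isHermitian {a b : ℝ} {A : Matrix (Fin m) (Fin m) ℂ}
    (h : OpWithin a b A) : A.IsHermitian := by
  have := h.left.1.add (isHermitian_real_smul_one a)
  simpa using this

theorem OpWithin.mono {a b a' b' : ℝ} {A : Matrix (Fin m) (Fin m) ℂ}
    (h : OpWithin a b A) (ha : a' ≤ a) (hb : b ≤ b') : OpWithin a' b' A := by
  constructor
  · have := h.left.add (posSemidef_real_smul (Matrix.PosSemidef.one (n := Fin m) (R := ℂ))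
      (sub_nonneg.2 ha))
    convert this using 1
    rw [sub_smul]; abel
  · have := h.right.add (posSemidef_real_smul (Matrix.PosSemidef.one (n := Fin m) (R := ℂ))
      (sub_nonneg.2 hb))
    convert this using 1
    rw [sub_smul]; abel

theorem OpWithin.sub_one {a b : ℝ} {A : Matrix (Fin m) (Fin m) ℂ}
    (h : OpWithin a b A) : OpWithin (a - 1) (b - 1) (A - 1) := by
  constructor
  · convert h.left using 1
    rw [sub_smul, one_smul]; abel
  · convert h.right using 1
    rw [sub_smul, one_smul]; abel

/-- Follows from `A⁻¹ - b⁻¹ = (1 - b⁻¹A) A⁻¹ (1 - b⁻¹A) + b⁻²(b - A)`. -/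
theorem inv_sub_posSemidef {b : ℝ} (hb : 0 < b) {A : Matrix (Fin m) (Fin m) ℂ} (hA : A.PosDef)
    (h : (b • (1 : Matrix (Fin m) (Fin m) ℂ) - A).PosSemidef) :
    (A⁻¹ - b⁻¹ • (1 : Matrix (Fin m) (Fin m) ℂ)).PosSemidef := by
  have hu : IsUnit A.det := (Matrix.isUnit_iff_isUnit_det A).1 hA.isUnit
  have hC : (1 - b⁻¹ • A).IsHermitian :=
    Matrix.isHermitian_one.sub (isHermitian_real_smul hA.isHermitian _)
  have h1 := (posSemidef_conj_hermitian hA.inv.posSemidef hC).add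
    (posSemidef_real_smul h (a := b⁻¹ * b⁻¹) (by positivity))
  convert h1 using 1
  have e1 : A⁻¹ * A = 1 := Matrix.nonsing_inv_mul A hu
  have e2 : A * A⁻¹ = 1 := Matrix.mul_nonsing_inv A hu
  have hb' : b⁻¹ * b⁻¹ * b = b⁻¹ := by field_simp
  simp only [sub_mul, mul_sub, Matrix.smul_mul, Matrix.mul_smul, one_mul, mul_one, e1, e2, smul_sub,
    smul_smul, hb']
  abel

/-- Follows from `a⁻¹ - A⁻¹ = a⁻¹ A⁻¹ ((A - a)² + a(A - a)) A⁻¹`. -/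
theorem sub_inv_posSemidef {a : ℝ} (ha : 0 < a) {A : Matrix (Fin m) (Fin m) ℂ}
    (h : (A - a • (1 : Matrix (Fin m) (Fin m) ℂ)).PosSemidef) :
    (a⁻¹ • (1 : Matrix (Fin m) (Fin m) ℂ) - A⁻¹).PosSemidef := by
  have hA := posDef_of_sub_smul_one ha h
  have hu : IsUnit A.det := (Matrix.isUnit_iff_isUnit_det A).1 hA.isUnit
  have h0 : ((A - a • (1 : Matrix (Fin m) (Fin m) ℂ)) * (A - a • 1)).PosSemidef := by
    have := Matrix.posSemidef_conjTranspose_mul_self (A - a • (1 : Matrix (Fin m) (Fin m) ℂ))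
    rwa [h.1.eq] at this
  have h1 := posSemidef_real_smul (posSemidef_conj_hermitian
    (h0.add (posSemidef_real_smul h ha.le)) hA.inv.isHermitian) (inv_nonneg.2 ha.le)
  convert h1 using 1
  have e1 : A⁻¹ * A = 1 := Matrix.nonsing_inv_mul A hu
  have e2 : A * A⁻¹ = 1 := Matrix.mul_nonsing_inv A hu
  have e3 : A⁻¹ * (A * A) * A⁻¹ = 1 := by
    rw [← Matrix.mul_assoc, e1, one_mul, e2]
  simp only [sub_mul, mul_sub, mul_add, add_mul, Matrix.smul_mul, Matrix.mul_smul, one_mul, mul_one,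
    smul_sub, smul_add, smul_smul, e1, e3, inv_mul_cancel₀ ha.ne', one_smul]
  abel

theorem OpWithin.inv {a b : ℝ} (ha : 0 < a) (hb : 0 < b) {A : Matrix (Fin m) (Fin m) ℂ}
    (h : OpWithin a b A) : OpWithin b⁻¹ a⁻¹ A⁻¹ :=
  ⟨inv_sub_posSemidef hb (h.posDef ha) h.right, sub_inv_posSemidef ha h.left⟩

theorem OpWithin.inv_self {q : ℝ} (hq : 0 < q) {A : Matrix (Fin m) (Fin m) ℂ}
    (h : OpWithin q⁻¹ q A) : OpWithin q⁻¹ q A⁻¹ := by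
  simpa using h.inv (inv_pos.2 hq) hq

/-- Follows from `2q(q - R) = (q - R)² + (q² - R²)`; no positivity of `R` is needed. -/
theorem smul_one_sub_of_mul_self {q : ℝ} (hq : 0 < q) {R : Matrix (Fin m) (Fin m) ℂ}
    (hR : R.IsHermitian) (h : ((q * q) • (1 : Matrix (Fin m) (Fin m) ℂ) - R * R).PosSemidef) :
    (q • (1 : Matrix (Fin m) (Fin m) ℂ) - R).PosSemidef := by
  have h0 : ((q • (1 : Matrix (Fin m) (Fin m) ℂ) - R) * (q • 1 - R)).PosSemidef := by
    have := Matrix.posSemidef_conjTranspose_mul_self (q • (1 : Matrix (Fin m) (Fin m) ℂ) - R)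
    rwa [((isHermitian_real_smul_one q).sub hR).eq] at this
  have h1 := posSemidef_real_smul (h0.add h) (a := (2 * q)⁻¹) (by positivity)
  convert h1 using 1
  have e0 : (q • (1 : Matrix (Fin m) (Fin m) ℂ) - R) * (q • 1 - R) +
      ((q * q) • (1 : Matrix (Fin m) (Fin m) ℂ) - R * R) = (2 * q) • (q • 1 - R) := by
    simp only [sub_mul, mul_sub, Matrix.smul_mul, Matrix.mul_smul, one_mul, mul_one,
      smul_sub, smul_smul]
    module
  rw [e0, smul_smul, inv_mul_cancel₀ (by positivity), one_smul]

/-- A positive definite square root of a matrix with spectrum in `[q⁻¹, q]` has its spectrum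
there too. -/
theorem OpWithin.of_mul_self {q : ℝ} (hq : 1 ≤ q) {R : Matrix (Fin m) (Fin m) ℂ}
    (hR : R.PosDef) (h : OpWithin q⁻¹ q (R * R)) : OpWithin q⁻¹ q R := by
  have hq0 : 0 < q := by linarith
  have key : ∀ {S : Matrix (Fin m) (Fin m) ℂ}, S.IsHermitian → OpWithin q⁻¹ q (S * S) →
      (q • (1 : Matrix (Fin m) (Fin m) ℂ) - S).PosSemidef := fun hS h' =>
    smul_one_sub_of_mul_self hq0 hS (h'.mono le_rfl (by nlinarith)).right
  refine ⟨?_, key hR.isHermitian h⟩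
  -- The lower bound for `R` is the upper bound for `R⁻¹`, inverted.
  have h2 : OpWithin q⁻¹ q (R⁻¹ * R⁻¹) := by
    have := h.inv_self hq0
    rwa [Matrix.mul_inv_rev] at this
  have h3 := inv_sub_posSemidef hq0 hR.inv (key hR.inv.isHermitian h2)
  rwa [Matrix.nonsing_inv_nonsing_inv _ ((Matrix.isUnit_iff_isUnit_det R).1 hR.isUnit)] at h3

end PositiveSemidefinite

/-! ### Frobenius norm of products with spectrally bounded factors. -/

section Frobenius

open scoped Matrix.Norms.Frobenius

variable {m k : ℕ}

theorem frobenius_sq_rect (M : Matrix (Fin m) (Fin k) ℂ) : (Mᴴ * M).trace.re = ‖M‖ ^ 2 := by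
  rw [Matrix.frobenius_norm_def, ← Real.sqrt_eq_rpow, Real.sq_sqrt (by positivity),
    Finset.sum_comm]
  simp [Matrix.trace, Matrix.mul_apply, Complex.sq_norm, Complex.normSq_apply]

theorem trace_mul_self_re {M : Matrix (Fin m) (Fin m) ℂ} (h : M.IsHermitian) :
    (M * M).trace.re = ‖M‖ ^ 2 := by
  rw [← frobenius_sq, h.eq]

theorem trace_mul_re_le (A B : Matrix (Fin m) (Fin m) ℂ) (hA : A.IsHermitian)
    (hB : B.IsHermitian) : (A * B).trace.re ≤ ‖A‖ * ‖B‖ := by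
  obtain ⟨X, rfl⟩ := Herm.exists_toMat_eq hA
  obtain ⟨Y, rfl⟩ := Herm.exists_toMat_eq hB
  have := real_inner_le_norm X Y
  rwa [Herm.inner_def, hA.eq, Herm.norm_eq_frobenius, Herm.norm_eq_frobenius] at this

theorem OpWithin.norm_mul_le {a : ℝ} (ha : 0 < a) {A : Matrix (Fin m) (Fin m) ℂ}
    (h : OpWithin (-a) a A) (B : Matrix (Fin m) (Fin m) ℂ) : ‖A * B‖ ≤ a * ‖B‖ := by
  have hA := h.isHermitian
  have h1 := h.left
  have h2 := h.right
  set S := A - (-a) • (1 : Matrix (Fin m) (Fin m) ℂ) with hS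
  set T := a • (1 : Matrix (Fin m) (Fin m) ℂ) - A with hT
  -- `S` and `T` commute and `S + T = 2a`, so `TST + STS = 2a(a² - A²)`; each summand is a
  -- congruence of a positive semidefinite matrix.
  have h3 := posSemidef_real_smul ((posSemidef_conj_hermitian h1 h2.1).add
    (posSemidef_conj_hermitian h2 h1.1)) (a := (2 * a)⁻¹) (by positivity)
  have e : (2 * a)⁻¹ • (T * S * T + S * T * S) = (a * a) • 1 - A * A := by
    have e0 : T * S * T + S * T * S = (2 * a) • ((a * a) • 1 - A * A) := by
      rw [hS, hT]
      simp only [sub_mul, mul_sub, Matrix.smul_mul, Matrix.mul_smul, one_mul, mul_one,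
        smul_sub, smul_smul]
      module
    rw [e0, smul_smul, inv_mul_cancel₀ (by positivity), one_smul]
  rw [e] at h3
  have h4 := trace_re_nonneg (h3.conjTranspose_mul_mul_same B)
  have e2 : Bᴴ * ((a * a) • 1 - A * A) * B = (a * a) • (Bᴴ * B) - (A * B)ᴴ * (A * B) := by
    rw [Matrix.conjTranspose_mul, hA.eq]
    simp only [sub_mul, mul_sub, Matrix.smul_mul, Matrix.mul_smul, mul_one, Matrix.mul_assoc]
  rw [e2, Matrix.trace_sub, Matrix.trace_smul, Complex.sub_re, Complex.smul_re, frobenius_sq,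
    frobenius_sq, smul_eq_mul] at h4
  exact abs_le_of_sq_le_sq' (by nlinarith) (by positivity) |>.2

theorem OpWithin.norm_mul_le' {a : ℝ} (ha : 0 < a) {A : Matrix (Fin m) (Fin m) ℂ}
    (h : OpWithin (-a) a A) (B : Matrix (Fin m) (Fin m) ℂ) : ‖B * A‖ ≤ a * ‖B‖ := by
  rw [← Matrix.frobenius_norm_conjTranspose, Matrix.conjTranspose_mul, h.isHermitian.eq,
    ← Matrix.frobenius_norm_conjTranspose B]
  exact h.norm_mul_le ha _

end Frobenius

/-! ### Spectral decomposition into rank-one projections. -/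

section Spectral

variable {m : ℕ}

theorem _root_.Matrix.IsHermitian.exists_spectral_projections {A : Matrix (Fin m) (Fin m) ℂ}
    (hA : A.IsHermitian) : ∃ P : Fin m → Matrix (Fin m) (Fin m) ℂ,
      A = ∑ i, hA.eigenvalues i • P i ∧ ∑ i, P i = 1 ∧ (∀ i, (P i).PosSemidef) ∧ (∀ i, (P i).trace = 1) ∧
      ∀ i j, P i * P j = if i = j then P i else 0 := by
  set U : Matrix (Fin m) (Fin m) ℂ := (hA.eigenvectorUnitary : Matrix (Fin m) (Fin m) ℂ)
  have hU1 : Uᴴ * U = 1 := Unitary.coe_star_mul_self hA.eigenvectorUnitary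
  have hU2 : U * Uᴴ = 1 := Unitary.coe_mul_star_self hA.eigenvectorUnitary
  have hs : ∀ i : Fin m, (Matrix.single i i (1 : ℂ)).PosSemidef := fun i => by
    rw [← Matrix.diagonal_single]
    exact Matrix.PosSemidef.diagonal (by
      intro j; by_cases h : j = i
      · subst h; simp
      · simp [h])
  refine ⟨fun i => U * Matrix.single i i 1 * Uᴴ, ?_, ?_, ?_, ?_, ?_⟩
  · conv_lhs => rw [hA.spectral_theorem, Unitary.conjStarAlgAut_apply]
    have : Matrix.diagonal (RCLike.ofReal ∘ hA.eigenvalues : Fin m → ℂ) =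
        ∑ i, hA.eigenvalues i • Matrix.single i i (1 : ℂ) := by
      rw [← Matrix.sum_single_eq_diagonal]
      simp [Matrix.smul_single]
    rw [this, Matrix.mul_sum, Matrix.sum_mul]
    simp only [Matrix.mul_smul, Matrix.smul_mul]
    rfl
  · rw [← Matrix.sum_mul, ← Matrix.mul_sum]
    have : ∑ i, Matrix.single i i (1 : ℂ) = (1 : Matrix (Fin m) (Fin m) ℂ) := by
      rw [Matrix.sum_single_eq_diagonal, Matrix.diagonal_one]
    rw [this, mul_one, hU2]
  · exact fun i => (hs i).mul_mul_conjTranspose_same U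
  · intro i
    dsimp only
    rw [Matrix.mul_assoc, Matrix.trace_mul_comm, Matrix.mul_assoc, hU1]
    simp
  · intro i j
    have : U * Matrix.single i i 1 * Uᴴ * (U * Matrix.single j j 1 * Uᴴ) =
        U * (Matrix.single i i 1 * (Uᴴ * U) * Matrix.single j j 1) * Uᴴ := by
      simp only [Matrix.mul_assoc]
    dsimp only
    rw [this, hU1, mul_one]
    split_ifs with h
    · subst h; simp
    · simp [h]

theorem sum_smul_mul_sum_smul {P : Fin m → Matrix (Fin m) (Fin m) ℂ}
    (hP : ∀ i j, P i * P j = if i = j then P i else 0) (x y : Fin m → ℝ) :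
    (∑ i, x i • P i) * (∑ i, y i • P i) = ∑ i, (x i * y i) • P i := by
  rw [Finset.sum_mul_sum]
  refine Finset.sum_congr rfl fun i _ => ?_
  rw [Finset.sum_eq_single i]
  · rw [Matrix.smul_mul, Matrix.mul_smul, hP, if_pos rfl, smul_smul]
  · intro j _ hj
    rw [Matrix.smul_mul, Matrix.mul_smul, hP, if_neg hj.symm, smul_zero, smul_zero]
  · simp

theorem posSemidef_sum_smul {ι : Type*} [Fintype ι] {B : ι → Matrix (Fin m) (Fin m) ℂ}
    (hB : ∀ i, (B i).PosSemidef) {x : ι → ℝ} (hx : ∀ i, 0 ≤ x i) :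
    (∑ i, x i • B i).PosSemidef :=
  Matrix.posSemidef_sum _ fun i _ => posSemidef_real_smul (hB i) (hx i)

/-- Only a positive resolution of the identity is required, not orthogonal projections, so the bound
also covers images of spectral projections under a positive unital map. -/
theorem OpWithin.sum_smul {ι : Type*} [Fintype ι] {B : ι → Matrix (Fin m) (Fin m) ℂ}
    (hB : ∀ i, (B i).PosSemidef) (hB1 : ∑ i, B i = 1) {x : ι → ℝ} {a b : ℝ}
    (ha : ∀ i, a ≤ x i) (hb : ∀ i, x i ≤ b) : OpWithin a b (∑ i, x i • B i) := by
  constructor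
  · convert posSemidef_sum_smul hB (fun i => sub_nonneg.2 (ha i)) using 1
    simp only [sub_smul, Finset.sum_sub_distrib, ← Finset.smul_sum, hB1]
  · convert posSemidef_sum_smul hB (fun i => sub_nonneg.2 (hb i)) using 1
    simp only [sub_smul, Finset.sum_sub_distrib, ← Finset.smul_sum, hB1]

end Spectral

/-! ### Differentiating `log det` and computing the geodesic gradient. -/

section Gradient

open scoped Matrix.Norms.Frobenius

variable {m k : ℕ}

theorem _root_.Matrix.differentiable_det :
    Differentiable ℝ (fun M : Matrix (Fin m) (Fin m) ℂ => M.det) := by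
  simp only [Matrix.det_apply]
  refine Differentiable.fun_sum fun σ _ => ?_
  simp only [Units.smul_def, zsmul_eq_mul]
  refine Differentiable.const_mul ?_ _
  exact (contDiff_prod (n := 1) fun i _ => (LinearMap.toContinuousLinearMap
    (Matrix.entryLinearMap ℝ ℂ (σ i) i)).contDiff).differentiable one_ne_zero

/-- Jacobi's formula at an invertible matrix. -/
theorem _root_.Matrix.fderiv_det {M : Matrix (Fin m) (Fin m) ℂ} (hM : IsUnit M.det)
    (H : Matrix (Fin m) (Fin m) ℂ) :
    fderiv ℝ (fun M : Matrix (Fin m) (Fin m) ℂ => M.det) M H = M.det * (M⁻¹ * H).trace := by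
  have h1 : HasDerivAt (fun t : ℝ => M + t • H) H 0 := by
    exact (((hasDerivAt_id (0 : ℝ)).smul_const H).const_add M).congr_deriv (one_smul ℝ H)
  have h2 : HasDerivAt (fun t : ℝ => (M + t • H).det)
      (fderiv ℝ (fun M : Matrix (Fin m) (Fin m) ℂ => M.det) M H) 0 := by
    refine HasFDerivAt.comp_hasDerivAt (l := fun M : Matrix (Fin m) (Fin m) ℂ => M.det) 0 ?_ h1
    rw [zero_smul, add_zero]
    exact (Matrix.differentiable_det (m := m) M).hasFDerivAt
  refine h2.unique ?_
  set N := M⁻¹ * H with hN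
  -- `det(1 + tN) = 1 + t tr N + t² r(t)` with `r` a polynomial, so only the trace survives at `t =
  -- 0`.
  have h3 : ∀ t : ℝ, (M + t • H).det = M.det * (1 + N.trace * (t : ℂ) +
      (Matrix.det (1 + (Polynomial.X : Polynomial ℂ) • N.map Polynomial.C)).divX.divX.eval (t : ℂ) *
        (t : ℂ) ^ 2) := by
    intro t
    rw [← Matrix.det_one_add_smul, ← Matrix.det_mul, Matrix.mul_add, mul_one, Matrix.mul_smul, hN,
      ← Matrix.mul_assoc, Matrix.mul_nonsing_inv M hM, one_mul, Complex.coe_smul]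
  simp only [h3]
  have ht : HasDerivAt (fun t : ℝ => (t : ℂ)) 1 0 := Complex.ofRealCLM.hasDerivAt
  have h4 := ((Polynomial.hasDerivAt (Matrix.det (1 + (Polynomial.X : Polynomial ℂ) •
    N.map Polynomial.C)).divX.divX ((0 : ℝ) : ℂ)).scomp (𝕜 := ℝ) 0 ht).mul (ht.pow 2)
  have h5 := (((ht.const_mul N.trace).const_add 1).add h4).const_mul M.det
  refine h5.congr_deriv ?_
  simp

theorem det_eq_re {M : Matrix (Fin m) (Fin m) ℂ} (hM : M.PosDef) : M.det = (M.det.re : ℂ) :=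
  Complex.ext rfl (Complex.pos_iff.1 hM.det_pos).2.symm

/-- The derivative at the origin of `X ↦ log det L(S e^X S)`. -/
theorem hasFDerivAt_log_det (L : Matrix (Fin m) (Fin m) ℂ →ₗ[ℂ] Matrix (Fin k) (Fin k) ℂ)
    (S : Matrix (Fin m) (Fin m) ℂ) (hL : (L (S * S)).PosDef) :
    ∃ D : Herm m →L[ℝ] ℝ,
      HasFDerivAt (fun X : Herm m => Real.log (L (S * NormedSpace.exp X.toMat * S)).det.re) D 0 ∧
        ∀ X, D X = ((L (S * S))⁻¹ * L (S * X.toMat * S)).trace.re := by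
  let T : Herm m →L[ℝ] Matrix (Fin m) (Fin m) ℂ := LinearMap.toContinuousLinearMap Herm.toMat
  let K : Matrix (Fin m) (Fin m) ℂ →L[ℝ] Matrix (Fin k) (Fin k) ℂ :=
    LinearMap.toContinuousLinearMap
      ((L.restrictScalars ℝ) ∘ₗ LinearMap.mulRight ℝ S ∘ₗ LinearMap.mulLeft ℝ S)
  have hT0 : T 0 = 0 := map_zero _
  -- At the origin the derivative of `exp` is the identity, so noncommutativity plays no role.
  have h1 : HasFDerivAt (fun X : Herm m => NormedSpace.exp (T X)) T 0 := by
    have he : HasFDerivAt (NormedSpace.exp : Matrix (Fin m) (Fin m) ℂ → _)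
        (1 : Matrix (Fin m) (Fin m) ℂ →L[ℝ] _) (T 0) := by
      rw [hT0]; exact hasFDerivAt_exp_zero
    exact he.comp (0 : Herm m) T.hasFDerivAt
  have h2 : HasFDerivAt (fun X : Herm m => K (NormedSpace.exp (T X))) (K.comp T) 0 :=
    K.hasFDerivAt.comp (0 : Herm m) h1
  have hK0 : K (NormedSpace.exp (T 0)) = L (S * S) := by
    rw [hT0, NormedSpace.exp_zero]
    simp [K]
  have h3 : HasFDerivAt (fun X : Herm m => (K (NormedSpace.exp (T X))).det)
      ((fderiv ℝ (fun M : Matrix (Fin k) (Fin k) ℂ => M.det) (L (S * S))).comp (K.comp T)) 0 := by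
    refine HasFDerivAt.comp (g := fun M : Matrix (Fin k) (Fin k) ℂ => M.det) (0 : Herm m) ?_ h2
    rw [hK0]
    exact (Matrix.differentiable_det _).hasFDerivAt
  have h4 := Complex.reCLM.hasFDerivAt.comp (0 : Herm m) h3
  have hpos : 0 < (L (S * S)).det.re := (Complex.pos_iff.1 hL.det_pos).1
  have h5 := h4.log (by simp only [Function.comp, hK0]; exact hpos.ne')
  refine ⟨_, h5, fun X => ?_⟩
  have hu : IsUnit (L (S * S)).det := (Matrix.isUnit_iff_isUnit_det _).1 hL.isUnit
  simp only [Function.comp, hK0]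
  simp only [smul_apply, ContinuousLinearMap.comp_apply, Complex.reCLM_apply,
    smul_eq_mul, Matrix.fderiv_det hu]
  rw [det_eq_re hL, Complex.re_ofReal_mul, Complex.ofReal_re, inv_mul_cancel_left₀ hpos.ne']
  rfl

open scoped MatrixOrder in
/-- The geodesic gradient of `f^Φ` at `Z` is `√Z (p/n) Φ*(Φ(Z)⁻¹) √Z - I`. -/
theorem geodesicGradient_capacityFun {p n : ℕ}
    (Φ : Matrix (Fin p) (Fin p) ℂ →ₗ[ℂ] Matrix (Fin n) (Fin n) ℂ)
    (hΦ : ∀ X : Matrix (Fin p) (Fin p) ℂ, X.IsHermitian → (Φ X).IsHermitian)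
    (hdual : ∀ Y : Matrix (Fin n) (Fin n) ℂ, Y.IsHermitian → (dual Φ Y).IsHermitian)
    {Z : Matrix (Fin p) (Fin p) ℂ} (hZ : Z.PosDef) (hΦZ : (Φ Z).PosDef) :
    GeodesicallyDifferentiableAt (capacityFun Φ) Z ∧
      (geodesicGradient (capacityFun Φ) Z).toMat =
        CFC.sqrt Z * (((p : ℝ) / n) • dual Φ (Φ Z)⁻¹) * CFC.sqrt Z - 1 := by
  set S := CFC.sqrt Z with hS
  have hSS : S * S = Z := CFC.sqrt_mul_sqrt_self Z hZ.posSemidef.nonneg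
  have hSh : S.IsHermitian := (Matrix.nonneg_iff_posSemidef.1 (CFC.sqrt_nonneg Z)).1
  obtain ⟨D₁, hD₁, hD₁'⟩ := hasFDerivAt_log_det Φ S (by rwa [hSS])
  obtain ⟨D₂, hD₂, hD₂'⟩ := hasFDerivAt_log_det LinearMap.id S (by simpa [hSS] using hZ)
  rw [hSS] at hD₁'
  simp only [LinearMap.id_apply, hSS] at hD₂ hD₂'
  have hfd : HasFDerivAt (fun X : Herm p => capacityFun Φ (geodesicCoord Z X))
      (((p : ℝ) / n) • D₁ - D₂) 0 := (hD₁.const_mul _).sub hD₂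
  have hGh : (S * (((p : ℝ) / n) • dual Φ (Φ Z)⁻¹) * S - 1).IsHermitian := by
    refine Matrix.IsHermitian.sub ?_ Matrix.isHermitian_one
    have := Matrix.isHermitian_conjTranspose_mul_mul S
      (isHermitian_real_smul (hdual _ hΦZ.inv.isHermitian) ((p : ℝ) / n))
    rwa [hSh.eq] at this
  obtain ⟨G, hG⟩ := Herm.exists_toMat_eq hGh
  have hgrad : HasGradientAt (fun X : Herm p => capacityFun Φ (geodesicCoord Z X)) G 0 := by
    rw [hasGradientAt_iff_hasFDerivAt]
    refine hfd.congr_fderiv (ContinuousLinearMap.ext fun X => Eq.symm ?_)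
    rw [InnerProductSpace.toDual_apply_apply, Herm.inner_def, hG, hGh.eq]
    simp only [sub_apply, smul_apply, hD₁', hD₂',
      smul_eq_mul]
    have e1 : (Z⁻¹ * (S * X.toMat * S)).trace = X.toMat.trace := by
      have hu : IsUnit Z.det := (Matrix.isUnit_iff_isUnit_det _).1 hZ.isUnit
      rw [Matrix.trace_mul_comm, Matrix.mul_assoc, Matrix.mul_assoc, Matrix.trace_mul_comm,
        Matrix.mul_assoc, Matrix.mul_assoc]
      have : S * (Z⁻¹ * S) = 1 := by
        have hSu : IsUnit S.det := by
          rw [← hSS, Matrix.det_mul] at hu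
          exact isUnit_of_mul_isUnit_left hu
        rw [← hSS, Matrix.mul_inv_rev, Matrix.mul_assoc, Matrix.nonsing_inv_mul S hSu, mul_one,
          Matrix.mul_nonsing_inv S hSu]
      rw [this, mul_one]
    have e2 : ((Φ Z)⁻¹ * Φ (S * X.toMat * S)).trace =
        (S * dual Φ (Φ Z)⁻¹ * S * X.toMat).trace := by
      have hX : (S * X.toMat * S).IsHermitian := by
        have := Matrix.isHermitian_conjTranspose_mul_mul S X.isHermitian_toMat
        rwa [hSh.eq] at this
      have := trace_dual Φ (S * X.toMat * S) (Φ Z)⁻¹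
      rw [(hΦ _ hX).eq, hX.eq, Matrix.trace_mul_comm] at this
      rw [this, Matrix.trace_mul_comm, ← Matrix.mul_assoc, Matrix.trace_mul_comm]
      simp only [Matrix.mul_assoc]
    rw [e1, e2]
    simp only [sub_mul, Matrix.mul_smul, Matrix.smul_mul, Matrix.trace_sub, Matrix.trace_smul,
      one_mul, Complex.sub_re, Complex.smul_re, smul_eq_mul]
  refine ⟨hfd.differentiableAt, ?_⟩
  rw [geodesicGradient, hgrad.gradient, hG]

end Gradient

/-! ### Quantitative convexity of `t ↦ log det ∑ᵢ e^{t wᵢ} Bᵢ`. -/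

section Convexity

variable {ι : Type*} [Fintype ι] {n : ℕ}

theorem sum_smul_conj_expand {B : ι → Matrix (Fin n) (Fin n) ℂ}
    (e w : ι → ℝ) (Q : Matrix (Fin n) (Fin n) ℂ) :
    ∑ i, e i • ((w i • 1 - Q)ᴴ * B i * (w i • 1 - Q)) =
      (∑ i, (e i * w i ^ 2) • B i) - (∑ i, (e i * w i) • B i) * Q -
        Qᴴ * (∑ i, (e i * w i) • B i) + Qᴴ * (∑ i, e i • B i) * Q := by
  simp only [Matrix.sum_mul, Matrix.mul_sum, ← Finset.sum_sub_distrib, ← Finset.sum_add_distrib]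
  refine Finset.sum_congr rfl fun i _ => ?_
  simp only [Matrix.conjTranspose_sub, Matrix.conjTranspose_smul, Matrix.conjTranspose_one,
    star_trivial, sub_mul, mul_sub, Matrix.smul_mul, Matrix.mul_smul, one_mul, mul_one]
  module

/-- The Schur complement `S` is the weighted variance `∑ eᵢ (wᵢ - Q)ᴴ Bᵢ (wᵢ - Q)` centred at `Q =
M⁻¹M₁`, hence positive semidefinite. Lowering the weights to `a` leaves an unweighted sum, whose
trace is smallest when centred at the mean `N = ∑ wᵢBᵢ`. Finally `M ≤ b` gives `M⁻¹ ≥ b⁻¹`. -/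
theorem trace_schur_lower {B : ι → Matrix (Fin n) (Fin n) ℂ} (hB : ∀ i, (B i).PosSemidef)
    (hB1 : ∑ i, B i = 1) (w : ι → ℝ) {e : ι → ℝ} {a b : ℝ} (ha : 0 < a) (hb : 0 < b)
    (hea : ∀ i, a ≤ e i) (heb : ∀ i, e i ≤ b) :
    let M := ∑ i, e i • B i
    let M₁ := ∑ i, (e i * w i) • B i
    let S := (∑ i, (e i * w i ^ 2) • B i) - M₁ * M⁻¹ * M₁
    0 ≤ (M⁻¹ * S).trace.re ∧
    a / b * ((∑ i, w i ^ 2 • B i).trace.re -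
      ((∑ i, w i • B i) * (∑ i, w i • B i)).trace.re) ≤ (M⁻¹ * S).trace.re := by
  intro M M₁ S
  have hM : OpWithin a b M := OpWithin.sum_smul hB hB1 hea heb
  have hMp := hM.posDef ha
  have hu : IsUnit M.det := (Matrix.isUnit_iff_isUnit_det _).1 hMp.isUnit
  have hM₁ : M₁.IsHermitian := by
    simp only [M₁, Matrix.IsHermitian, Matrix.conjTranspose_sum, Matrix.conjTranspose_smul,
      (hB _).1.eq, star_trivial]
  set N : Matrix (Fin n) (Fin n) ℂ := ∑ i, w i • B i with hN
  have hNh : N.IsHermitian := by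
    simp only [hN, Matrix.IsHermitian, Matrix.conjTranspose_sum, Matrix.conjTranspose_smul,
      (hB _).1.eq, star_trivial]
  set Q := M⁻¹ * M₁ with hQ
  have hQh : Qᴴ = M₁ * M⁻¹ := by
    rw [hQ, Matrix.conjTranspose_mul, hM₁.eq, hMp.inv.isHermitian.eq]
  have hterm : ∀ i, ((w i • 1 - Q)ᴴ * B i * (w i • 1 - Q)).PosSemidef := fun i =>
    (hB i).conjTranspose_mul_mul_same _
  have hS : S = ∑ i, e i • ((w i • 1 - Q)ᴴ * B i * (w i • 1 - Q)) := by
    rw [sum_smul_conj_expand]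
    have e1 : Qᴴ * (∑ i, e i • B i) * Q = Qᴴ * M₁ := by
      change Qᴴ * M * Q = _
      rw [Matrix.mul_assoc, hQ, ← Matrix.mul_assoc M, Matrix.mul_nonsing_inv M hu, one_mul]
    rw [e1, sub_add_cancel, hQ, ← Matrix.mul_assoc]
  have hSp : S.PosSemidef := by
    rw [hS]
    exact posSemidef_sum_smul hterm fun i => ha.le.trans (hea i)
  refine ⟨trace_mul_re_nonneg hMp.inv.posSemidef hSp, ?_⟩
  have h1 : b⁻¹ * S.trace.re ≤ (M⁻¹ * S).trace.re := by
    have := trace_mul_re_nonneg (inv_sub_posSemidef hb hMp hM.right) hSp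
    rw [sub_mul, Matrix.smul_mul, one_mul, Matrix.trace_sub, Matrix.trace_smul, Complex.sub_re,
      Complex.smul_re, smul_eq_mul] at this
    linarith
  have h2 : a * ((∑ i, w i ^ 2 • B i).trace.re - (N * N).trace.re) ≤ S.trace.re := by
    have h3 := trace_re_nonneg (posSemidef_sum_smul hterm fun i => sub_nonneg.2 (hea i))
    simp only [sub_smul, Finset.sum_sub_distrib] at h3
    rw [← hS, ← Finset.smul_sum, Matrix.trace_sub S, Matrix.trace_smul, Complex.sub_re,
      Complex.smul_re, smul_eq_mul] at h3
    have h4 := sum_smul_conj_expand (B := B) (fun _ => 1) w Q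
    simp only [one_smul, one_mul, hB1, mul_one, ← hN] at h4
    rw [h4] at h3
    have h5 := trace_re_nonneg (Matrix.posSemidef_conjTranspose_mul_self (Q - N))
    -- Completing the square: moving the centre from `N` to `Q` costs `(Q - N)ᴴ(Q - N)`.
    have h6 : (∑ i, w i ^ 2 • B i) - N * Q - Qᴴ * N + Qᴴ * Q =
        (∑ i, w i ^ 2 • B i) - N * N + (Q - N)ᴴ * (Q - N) := by
      rw [Matrix.conjTranspose_sub, hNh.eq]
      noncomm_ring
    rw [h6, Matrix.trace_add, Matrix.trace_sub _ (N * N), Complex.add_re,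
      Complex.sub_re _ (N * N).trace] at h3
    nlinarith
  calc _ = b⁻¹ * (a * ((∑ i, w i ^ 2 • B i).trace.re - (N * N).trace.re)) := by
        rw [div_eq_mul_inv]; ring
    _ ≤ b⁻¹ * S.trace.re := mul_le_mul_of_nonneg_left h2 (inv_nonneg.2 hb.le)
    _ ≤ _ := h1

/-- The derivative of `t ↦ log det ∑ᵢ e^{t wᵢ} Bᵢ`. -/
noncomputable def logDetSlope (B : ι → Matrix (Fin n) (Fin n) ℂ) (w : ι → ℝ) (t : ℝ) : ℝ :=
  ((∑ i, Real.exp (t * w i) • B i)⁻¹ * ∑ i, (Real.exp (t * w i) * w i) • B i).trace.re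

open scoped Matrix.Norms.Frobenius in
-- Product rule with `(M⁻¹)' = -M⁻¹M'M⁻¹`, arranged so that the Schur complement of
-- `trace_schur_lower` appears.
theorem hasDerivAt_logDetSlope {B : ι → Matrix (Fin n) (Fin n) ℂ} {w : ι → ℝ} {t : ℝ}
    (hM : (∑ i, Real.exp (t * w i) • B i).PosDef) :
    HasDerivAt (logDetSlope B w)
      (((∑ i, Real.exp (t * w i) • B i)⁻¹ * ((∑ i, (Real.exp (t * w i) * w i ^ 2) • B i) -
        (∑ i, (Real.exp (t * w i) * w i) • B i) * (∑ i, Real.exp (t * w i) • B i)⁻¹ *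
          (∑ i, (Real.exp (t * w i) * w i) • B i))).trace.re) t := by
  have he : ∀ i, HasDerivAt (fun t : ℝ => Real.exp (t * w i)) (Real.exp (t * w i) * w i) t :=
    fun i => by simpa using ((hasDerivAt_id t).mul_const (w i)).exp
  have h0 : HasDerivAt (fun t : ℝ => ∑ i, Real.exp (t * w i) • B i)
      (∑ i, (Real.exp (t * w i) * w i) • B i) t :=
    HasDerivAt.fun_sum fun i _ => (he i).smul_const (B i)
  have h1 : HasDerivAt (fun t : ℝ => ∑ i, (Real.exp (t * w i) * w i) • B i)
      (∑ i, (Real.exp (t * w i) * w i ^ 2) • B i) t := by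
    refine HasDerivAt.fun_sum fun i _ => ?_
    refine (((he i).mul_const (w i)).smul_const (B i)).congr_deriv ?_
    rw [pow_two, mul_assoc]
  have : CompleteSpace (Matrix (Fin n) (Fin n) ℂ) := FiniteDimensional.complete ℝ _
  obtain ⟨u, hu⟩ := hM.isUnit
  have hinv : HasDerivAt (fun t : ℝ => (∑ i, Real.exp (t * w i) • B i)⁻¹)
      (-((∑ i, Real.exp (t * w i) • B i)⁻¹ * (∑ i, (Real.exp (t * w i) * w i) • B i) *
        (∑ i, Real.exp (t * w i) • B i)⁻¹)) t := by
    simp only [Matrix.nonsing_inv_eq_ringInverse]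
    have h2 := hasFDerivAt_ringInverse (𝕜 := ℝ) u
    rw [hu] at h2
    have h3 := h2.comp_hasDerivAt t h0
    refine h3.congr_deriv ?_
    rw [← hu, Ring.inverse_unit]
    simp only [neg_apply, ContinuousLinearMap.mulLeftRight_apply]
  have h4 := hinv.mul h1
  let L : Matrix (Fin n) (Fin n) ℂ →L[ℝ] ℝ := LinearMap.toContinuousLinearMap
    (Complex.reLm ∘ₗ (Matrix.traceLinearMap (Fin n) ℝ ℂ))
  have h5 := L.hasFDerivAt.comp_hasDerivAt t h4
  refine HasDerivAt.congr_deriv (f := logDetSlope B w) h5 ?_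
  change Complex.re (Matrix.trace _) = Complex.re (Matrix.trace _)
  congr 2
  rw [mul_sub, neg_mul, neg_add_eq_sub]
  simp only [Matrix.mul_assoc]

theorem posDef_sum_exp {B : ι → Matrix (Fin n) (Fin n) ℂ} (hB : ∀ i, (B i).PosSemidef)
    (hB1 : ∑ i, B i = 1) (x : ι → ℝ) : (∑ i, Real.exp (x i) • B i).PosDef :=
  (OpWithin.sum_smul hB hB1 (a := Real.exp (-∑ i, |x i|)) (b := Real.exp (∑ i, |x i|))
    (fun i => Real.exp_le_exp.2 (neg_le.1 ((neg_le_abs _).trans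
      (Finset.single_le_sum (f := fun i => |x i|) (fun _ _ => abs_nonneg _) (Finset.mem_univ i)))))
    (fun i => Real.exp_le_exp.2 ((le_abs_self _).trans
      (Finset.single_le_sum (f := fun i => |x i|) (fun _ _ => abs_nonneg _)
        (Finset.mem_univ i))))).posDef (Real.exp_pos _)

/-- The strong bound on the second derivative is used only on `[0, t₀]`, where the weights lie in
`[e^{-d}, e^d]` and so have ratio at least `e^{-2d}`. From `t₀` to `1` monotonicity of the slope
suffices, so the bound does not deteriorate when the `wᵢ` are large. -/
theorem logDetSlope_lower {B : ι → Matrix (Fin n) (Fin n) ℂ} (hB : ∀ i, (B i).PosSemidef)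
    (hB1 : ∑ i, B i = 1) (w : ι → ℝ) {t₀ d : ℝ} (ht₀ : 0 ≤ t₀) (ht₁ : t₀ ≤ 1)
    (hd : ∀ i, |t₀ * w i| ≤ d) :
    (∑ i, w i • B i).trace.re + t₀ * (Real.exp (-(2 * d)) * ((∑ i, w i ^ 2 • B i).trace.re -
      ((∑ i, w i • B i) * (∑ i, w i • B i)).trace.re)) ≤ logDetSlope B w 1 := by
  have hder : ∀ t, HasDerivAt (logDetSlope B w) _ t := fun t =>
    hasDerivAt_logDetSlope (posDef_sum_exp hB hB1 fun i => t * w i)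
  have hbd : ∀ t (i : ι), |t * w i| ≤ ∑ i, |t * w i| := fun t i =>
    Finset.single_le_sum (f := fun i => |t * w i|) (fun _ _ => abs_nonneg _) (Finset.mem_univ i)
  have hmono : Monotone (logDetSlope B w) := by
    refine monotone_of_deriv_nonneg (fun t => (hder t).differentiableAt) fun t => ?_
    rw [(hder t).deriv]
    exact (trace_schur_lower hB hB1 w (Real.exp_pos (-∑ i, |t * w i|))
      (Real.exp_pos (∑ i, |t * w i|)) (fun i => Real.exp_le_exp.2 (abs_le.1 (hbd t i)).1)
      (fun i => Real.exp_le_exp.2 (abs_le.1 (hbd t i)).2)).1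
  have h0 : logDetSlope B w 0 = (∑ i, w i • B i).trace.re := by
    simp [logDetSlope, hB1]
  have hmv : Real.exp (-(2 * d)) * ((∑ i, w i ^ 2 • B i).trace.re -
      ((∑ i, w i • B i) * (∑ i, w i • B i)).trace.re) * (t₀ - 0) ≤
        logDetSlope B w t₀ - logDetSlope B w 0 := by
    refine Convex.mul_sub_le_image_sub_of_le_deriv (convex_Icc 0 t₀)
      (fun t _ => (hder t).continuousAt.continuousWithinAt)
      (fun t _ => (hder t).differentiableAt.differentiableWithinAt) (fun t ht => ?_) 0
      (Set.left_mem_Icc.2 ht₀) t₀ (Set.right_mem_Icc.2 ht₀) ht₀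
    rw [interior_Icc] at ht
    rw [(hder t).deriv]
    have hti : ∀ i, |t * w i| ≤ d := fun i => by
      refine le_trans ?_ (hd i)
      rw [abs_mul, abs_mul, abs_of_pos ht.1, abs_of_nonneg ht₀]
      exact mul_le_mul_of_nonneg_right ht.2.le (abs_nonneg _)
    have := (trace_schur_lower hB hB1 w (Real.exp_pos (-d)) (Real.exp_pos d)
      (fun i => Real.exp_le_exp.2 (abs_le.1 (hti i)).1)
      (fun i => Real.exp_le_exp.2 (abs_le.1 (hti i)).2)).2
    rwa [← Real.exp_sub, show -d - d = -(2 * d) by ring] at this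
  have := hmono ht₁
  rw [h0] at hmv
  linarith

end Convexity

/-! ### Adjoint pairs of positive unital maps and contraction of one Sinkhorn step. -/

section UnitalPair

open scoped Matrix.Norms.Frobenius

variable {p n : ℕ}

theorem trace_eq_re {m : ℕ} {X : Matrix (Fin m) (Fin m) ℂ} (hX : X.IsHermitian) :
    X.trace = (X.trace.re : ℂ) := by
  have h : star X.trace = X.trace := by rw [← Matrix.trace_conjTranspose, hX.eq]
  exact (Complex.conj_eq_iff_re.1 h).symm

/-- Positive unital maps `Φ`, `Ψ` that are adjoint to each other up to the factor `κ`. -/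
structure IsUnitalPair (κ : ℝ) (Φ : Matrix (Fin p) (Fin p) ℂ →ₗ[ℂ] Matrix (Fin n) (Fin n) ℂ)
    (Ψ : Matrix (Fin n) (Fin n) ℂ →ₗ[ℂ] Matrix (Fin p) (Fin p) ℂ) : Prop where
  pos : 0 < κ
  dim_pos : 0 < p
  map_posSemidef : ∀ X, X.PosSemidef → (Φ X).PosSemidef
  map_posSemidef' : ∀ Y, Y.PosSemidef → (Ψ Y).PosSemidef
  map_isHermitian : ∀ X, X.IsHermitian → (Φ X).IsHermitian
  map_isHermitian' : ∀ Y, Y.IsHermitian → (Ψ Y).IsHermitian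
  map_one : Φ 1 = 1
  map_one' : Ψ 1 = 1
  adjoint : ∀ X Y, X.IsHermitian → Y.IsHermitian →
    κ * (Φ X * Y).trace.re = (X * Ψ Y).trace.re

theorem norm_smul_one_add_sq {m : ℕ} {M : Matrix (Fin m) (Fin m) ℂ} (hM : M.IsHermitian)
    (h0 : M.trace.re = 0) (r : ℝ) : ‖r • 1 + M‖ ^ 2 = r ^ 2 * m + ‖M‖ ^ 2 := by
  rw [← trace_mul_self_re ((isHermitian_real_smul_one r).add hM), ← trace_mul_self_re hM]
  have : (r • 1 + M) * (r • 1 + M) = (r ^ 2) • 1 + (2 * r) • M + M * M := by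
    simp only [add_mul, mul_add, Matrix.smul_mul, Matrix.mul_smul, one_mul, mul_one]
    module
  rw [this, Matrix.trace_add, Matrix.trace_add, Matrix.trace_smul, Matrix.trace_smul,
    Matrix.trace_one]
  simp only [Complex.add_re, Complex.smul_re, h0, Fintype.card_fin, Complex.natCast_re,
    smul_eq_mul, mul_zero, add_zero]

variable {κ : ℝ} {Φ : Matrix (Fin p) (Fin p) ℂ →ₗ[ℂ] Matrix (Fin n) (Fin n) ℂ}
  {Ψ : Matrix (Fin n) (Fin n) ℂ →ₗ[ℂ] Matrix (Fin p) (Fin p) ℂ}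

theorem map_real_smul {m k : ℕ} (L : Matrix (Fin m) (Fin m) ℂ →ₗ[ℂ] Matrix (Fin k) (Fin k) ℂ)
    (a : ℝ) (X : Matrix (Fin m) (Fin m) ℂ) : L (a • X) = a • L X := by
  rw [← Complex.coe_smul, map_smul, Complex.coe_smul]

theorem inv_real_smul {m : ℕ} {a : ℝ} (ha : a ≠ 0) {M : Matrix (Fin m) (Fin m) ℂ}
    (hM : M.PosDef) : (a • M)⁻¹ = a⁻¹ • M⁻¹ := by
  refine Matrix.inv_eq_left_inv ?_
  rw [Matrix.smul_mul, Matrix.mul_smul, smul_smul, inv_mul_cancel₀ ha, one_smul,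
    Matrix.nonsing_inv_mul _ ((Matrix.isUnit_iff_isUnit_det _).1 hM.isUnit)]

/-- A positive unital map preserves positive definiteness. -/
theorem posDef_map_of_unital {m k : ℕ} (L : Matrix (Fin m) (Fin m) ℂ →ₗ[ℂ] Matrix (Fin k) (Fin k) ℂ)
    (hL : ∀ X, X.PosSemidef → (L X).PosSemidef) (hL1 : L 1 = 1) {Z : Matrix (Fin m) (Fin m) ℂ}
    (hZ : Z.PosDef) : (L Z).PosDef := by
  obtain ⟨P, hZP, hP1, hPpos, -⟩ := hZ.isHermitian.exists_spectral_projections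
  have := posDef_sum_exp (fun i => hL _ (hPpos i)) (by rw [← map_sum, hP1, hL1])
    fun i => Real.log (hZ.isHermitian.eigenvalues i)
  simp only [Real.exp_log (hZ.eigenvalues_pos _), ← map_real_smul, ← map_sum] at this
  rwa [← hZP] at this

namespace IsUnitalPair

theorem map_posDef (h : IsUnitalPair κ Φ Ψ) {Z : Matrix (Fin p) (Fin p) ℂ} (hZ : Z.PosDef) :
    (Φ Z).PosDef := posDef_map_of_unital Φ h.map_posSemidef h.map_one hZ

theorem map_posDef' (h : IsUnitalPair κ Φ Ψ) {Y : Matrix (Fin n) (Fin n) ℂ} (hY : Y.PosDef) :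
    (Ψ Y).PosDef := posDef_map_of_unital Ψ h.map_posSemidef' h.map_one' hY

theorem opWithin (h : IsUnitalPair κ Φ Ψ) {a b : ℝ} {X : Matrix (Fin p) (Fin p) ℂ}
    (hX : OpWithin a b X) : OpWithin a b (Φ X) := by
  constructor
  · simpa [map_real_smul, h.map_one] using h.map_posSemidef _ hX.left
  · simpa [map_real_smul, h.map_one] using h.map_posSemidef _ hX.right

theorem opWithin' (h : IsUnitalPair κ Φ Ψ) {a b : ℝ} {Y : Matrix (Fin n) (Fin n) ℂ}
    (hY : OpWithin a b Y) : OpWithin a b (Ψ Y) := by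
  constructor
  · simpa [map_real_smul, h.map_one'] using h.map_posSemidef' _ hY.left
  · simpa [map_real_smul, h.map_one'] using h.map_posSemidef' _ hY.right

theorem trace_map (h : IsUnitalPair κ Φ Ψ) {X : Matrix (Fin p) (Fin p) ℂ} (hX : X.IsHermitian) :
    κ * (Φ X).trace.re = X.trace.re := by
  simpa [h.map_one'] using h.adjoint X 1 hX Matrix.isHermitian_one

theorem mul_dim (h : IsUnitalPair κ Φ Ψ) : κ * n = p := by
  simpa [h.map_one] using h.trace_map Matrix.isHermitian_one

/-- By adjointness `tr(Z Ψ(Φ(Z)⁻¹)) = κ tr(Φ(Z)Φ(Z)⁻¹) = κn = p`. This is what makes the expander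
bound applicable to the gradient. -/
theorem trace_gradient (h : IsUnitalPair κ Φ Ψ) {Z R : Matrix (Fin p) (Fin p) ℂ}
    (hZ : Z.IsHermitian) (hΦZ : (Φ Z).PosDef) (hR : R * R = Z) :
    (R * Ψ (Φ Z)⁻¹ * R - 1).trace.re = 0 := by
  have e : (R * Ψ (Φ Z)⁻¹ * R).trace = (Z * Ψ (Φ Z)⁻¹).trace := by
    rw [Matrix.trace_mul_comm, ← Matrix.mul_assoc, hR]
  rw [Matrix.trace_sub, Complex.sub_re, e, ← h.adjoint _ _ hZ hΦZ.inv.isHermitian,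
    Matrix.mul_nonsing_inv _ ((Matrix.isUnit_iff_isUnit_det _).1 hΦZ.isUnit)]
  simp [h.mul_dim]

/-- The scalar and traceless parts of `X` are orthogonal, and `Φ` respects the splitting. Since `κn
= p`, `√κ Φ` is isometric on scalars; on the traceless part it contracts. -/
theorem sqrt_mul_norm_map_le (h : IsUnitalPair κ Φ Ψ) {lam : ℝ} (h0 : 0 ≤ lam)
    (hexp : ∀ X : Matrix (Fin p) (Fin p) ℂ, X.IsHermitian → X.trace = 0 →
      √κ * ‖Φ X‖ ≤ (1 - lam) * ‖X‖) {X : Matrix (Fin p) (Fin p) ℂ} (hX : X.IsHermitian) :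
    √κ * ‖Φ X‖ ≤ ‖X‖ := by
  have hp : (0 : ℝ) < p := by exact_mod_cast h.dim_pos
  set r : ℝ := X.trace.re / p with hr
  set X₀ := X - r • (1 : Matrix (Fin p) (Fin p) ℂ) with hX₀
  have hXX : X = r • 1 + X₀ := by rw [hX₀]; abel
  have hX₀h : X₀.IsHermitian := hX.sub (isHermitian_real_smul_one r)
  have ht : X₀.trace.re = 0 := by
    rw [hX₀, Matrix.trace_sub, Matrix.trace_smul, Matrix.trace_one, hr]
    simp
    field_simp
    ring
  have htΦ : (Φ X₀).trace.re = 0 := by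
    have := h.trace_map hX₀h
    rw [ht] at this
    exact (mul_eq_zero.1 this).resolve_left h.pos.ne'
  have e1 := norm_smul_one_add_sq hX₀h ht r
  have e2 := norm_smul_one_add_sq (h.map_isHermitian _ hX₀h) htΦ r
  have hΦX : Φ X = r • 1 + Φ X₀ := by
    conv_lhs => rw [hXX]
    rw [map_add, map_real_smul, h.map_one]
  rw [← hXX] at e1
  rw [← hΦX] at e2
  have h3 := hexp X₀ hX₀h (by rw [trace_eq_re hX₀h, ht, Complex.ofReal_zero])
  have h4 : √κ * ‖Φ X₀‖ ≤ ‖X₀‖ := h3.trans (by nlinarith [norm_nonneg X₀])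
  have h5 : (√κ * ‖Φ X₀‖) ^ 2 ≤ ‖X₀‖ ^ 2 := pow_le_pow_left₀ (by positivity) h4 2
  refine abs_le_of_sq_le_sq' ?_ (norm_nonneg _) |>.2
  rw [mul_pow, Real.sq_sqrt h.pos.le] at h5 ⊢
  rw [e1, e2, ← h.mul_dim]
  linarith

/-- An adjoint has the same norm: `‖ΨY‖² = κ⟨ΦΨY, Y⟩`, then Cauchy–Schwarz. -/
theorem norm_map_le (h : IsUnitalPair κ Φ Ψ)
    (hne : ∀ X : Matrix (Fin p) (Fin p) ℂ, X.IsHermitian → √κ * ‖Φ X‖ ≤ ‖X‖)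
    {Y : Matrix (Fin n) (Fin n) ℂ} (hY : Y.IsHermitian) : ‖Ψ Y‖ ≤ √κ * ‖Y‖ := by
  have hΨ := h.map_isHermitian' Y hY
  have h1 := h.adjoint (Ψ Y) Y hΨ hY
  rw [trace_mul_self_re hΨ] at h1
  have h2 := trace_mul_re_le (Φ (Ψ Y)) Y (h.map_isHermitian _ hΨ) hY
  have h3 := hne _ hΨ
  have hk : √κ * √κ = κ := Real.mul_self_sqrt h.pos.le
  have h4 : ‖Ψ Y‖ ^ 2 ≤ √κ * ‖Y‖ * ‖Ψ Y‖ := by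
    calc ‖Ψ Y‖ ^ 2 ≤ κ * (‖Φ (Ψ Y)‖ * ‖Y‖) := by
          rw [← h1]; exact mul_le_mul_of_nonneg_left h2 h.pos.le
      _ = √κ * ‖Y‖ * (√κ * ‖Φ (Ψ Y)‖) := by nth_rewrite 1 [← hk]; ring
      _ ≤ _ := mul_le_mul_of_nonneg_left h3 (by positivity)
  by_cases h0 : ‖Ψ Y‖ = 0
  · rw [h0]; positivity
  · have : 0 < ‖Ψ Y‖ := lt_of_le_of_ne (norm_nonneg _) (Ne.symm h0)
    nlinarith

end IsUnitalPair

theorem OpWithin.sub_one_symm {q : ℝ} (hq : 1 < q) {m : ℕ} {A : Matrix (Fin m) (Fin m) ℂ}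
    (h : OpWithin q⁻¹ q A) : OpWithin (-(q - 1)) (q - 1) (A - 1) := by
  refine h.sub_one.mono ?_ le_rfl
  have : q * q⁻¹ = 1 := mul_inv_cancel₀ (by linarith)
  nlinarith [inv_pos.2 (zero_lt_one.trans hq)]

theorem OpWithin.symm {q : ℝ} (hq : 1 < q) {m : ℕ} {A : Matrix (Fin m) (Fin m) ℂ}
    (h : OpWithin q⁻¹ q A) : OpWithin (-q) q A := by
  refine h.mono ?_ le_rfl
  have := inv_pos.2 (zero_lt_one.trans hq)
  linarith

namespace IsUnitalPair

/-- One Sinkhorn step contracts the gradient near the identity. -/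
theorem norm_gradient_step_le (h : IsUnitalPair κ Φ Ψ) {lam : ℝ} (h0 : 0 ≤ lam)
    (hexp : ∀ X : Matrix (Fin p) (Fin p) ℂ, X.IsHermitian → X.trace = 0 →
      √κ * ‖Φ X‖ ≤ (1 - lam) * ‖X‖) {q : ℝ} (hq : 1 < q)
    {Z Z' R R' : Matrix (Fin p) (Fin p) ℂ} (hZ : OpWithin q⁻¹ q Z)
    (hZ' : Z' = (Ψ (Φ Z)⁻¹)⁻¹) (hR : R.PosDef) (hRR : R * R = Z)
    (hR' : R'.PosDef) (hRR' : R' * R' = Z') :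
    ‖R' * Ψ (Φ Z')⁻¹ * R' - 1‖ ≤ q ^ 4 * (q ^ 3 - lam) * ‖R * Ψ (Φ Z)⁻¹ * R - 1‖ := by
  have hq0 : 0 < q := by linarith
  have hqi : 0 < q⁻¹ := inv_pos.2 hq0
  have hne := fun X => h.sqrt_mul_norm_map_le h0 hexp (X := X)
  have hΦZ := h.opWithin hZ
  set H := (Φ Z)⁻¹ with hH
  have hHw : OpWithin q⁻¹ q H := hΦZ.inv_self hq0
  have hYw : OpWithin q⁻¹ q (Ψ H) := h.opWithin' hHw
  set Y := Ψ H with hY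
  have hZw' : OpWithin q⁻¹ q Z' := hZ' ▸ hYw.inv_self hq0
  have hΦZ' := h.opWithin hZw'
  set H' := (Φ Z')⁻¹ with hH'
  have hHw' : OpWithin q⁻¹ q H' := hΦZ'.inv_self hq0
  have hRw : OpWithin q⁻¹ q R := OpWithin.of_mul_self hq.le hR (hRR ▸ hZ)
  have hRw' : OpWithin q⁻¹ q R' := OpWithin.of_mul_self hq.le hR' (hRR' ▸ hZw')
  have hRiw : OpWithin q⁻¹ q R⁻¹ := hRw.inv_self hq0
  have unit : ∀ {m : ℕ} {A : Matrix (Fin m) (Fin m) ℂ}, OpWithin q⁻¹ q A → IsUnit A.det :=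
    fun hA => (Matrix.isUnit_iff_isUnit_det _).1 (hA.posDef hqi).isUnit
  set G := R * Y * R - 1 with hG
  have hGh : G.IsHermitian := by
    refine Matrix.IsHermitian.sub ?_ Matrix.isHermitian_one
    have := Matrix.isHermitian_conjTranspose_mul_mul R hYw.isHermitian
    rwa [hR.isHermitian.eq] at this
  have hGt : G.trace = 0 := by
    rw [trace_eq_re hGh, h.trace_gradient hZ.isHermitian (hΦZ.posDef hqi) hRR, Complex.ofReal_zero]
  -- `Z'` is exactly `Y⁻¹`, so the new gradient only sees the change `H' - H`.
  have hRY : R' * Y * R' = 1 := by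
    have : Y = R'⁻¹ * R'⁻¹ := by
      rw [← Matrix.mul_inv_rev, hRR', hZ', Matrix.nonsing_inv_nonsing_inv _ (unit hYw)]
    rw [this, ← Matrix.mul_assoc, Matrix.mul_nonsing_inv _ (unit hRw'), one_mul,
      Matrix.nonsing_inv_mul _ (unit hRw')]
  have hG' : R' * Ψ H' * R' - 1 = R' * Ψ (H' - H) * R' := by
    rw [map_sub, mul_sub, sub_mul, ← hY, hRY]
  have hHH : H' - H = H' * Φ (Z - Z') * H := by
    rw [map_sub, mul_sub, sub_mul, hH, hH', Matrix.nonsing_inv_mul _ (unit hΦZ'), one_mul,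
      Matrix.mul_assoc, Matrix.mul_nonsing_inv _ (unit hΦZ), mul_one]
  have hZZ : Z - Z' = Z' * R⁻¹ * G * R := by
    have e1 : R⁻¹ * R = 1 := Matrix.nonsing_inv_mul _ (unit hRw)
    have e2 : Z' * Y = 1 := by rw [hZ']; exact Matrix.nonsing_inv_mul _ (unit hYw)
    calc Z - Z' = Z' * Y * (R * R) - Z' := by rw [e2, one_mul, hRR]
      _ = Z' * (R⁻¹ * R) * Y * R * R - Z' * (R⁻¹ * R) := by
        rw [e1, mul_one]; simp only [Matrix.mul_assoc]
      _ = _ := by rw [hG]; noncomm_ring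
  -- `E` is the deviation from the first-order identity `Z - Z' ≈ G`. It need not be traceless, so
  -- it gets only the nonexpansive bound; only `G` gains `1 - λ`.
  set E := Z - Z' - G with hE
  have hEh : E.IsHermitian := (hZ.isHermitian.sub hZw'.isHermitian).sub hGh
  have hq1 : 0 < q - 1 := by linarith
  have hEn : ‖E‖ ≤ (q ^ 3 - 1) * ‖G‖ := by
    -- Replacing `Z'`, `R⁻¹`, `R` by `1` in turn costs `(q - 1)(q² + q + 1) = q³ - 1`.
    have e : E = (Z' - 1) * (R⁻¹ * (G * R)) + (R⁻¹ - 1) * (G * R) + G * (R - 1) := by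
      rw [hE, hZZ]; noncomm_ring
    have hGR : ‖G * R‖ ≤ q * ‖G‖ := (hRw.symm hq).norm_mul_le' hq0 _
    have n1 : ‖(Z' - 1) * (R⁻¹ * (G * R))‖ ≤ (q - 1) * (q * (q * ‖G‖)) :=
      ((hZw'.sub_one_symm hq).norm_mul_le hq1 _).trans (mul_le_mul_of_nonneg_left
        (((hRiw.symm hq).norm_mul_le hq0 _).trans (mul_le_mul_of_nonneg_left hGR hq0.le)) hq1.le)
    have n2 : ‖(R⁻¹ - 1) * (G * R)‖ ≤ (q - 1) * (q * ‖G‖) :=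
      ((hRiw.sub_one_symm hq).norm_mul_le hq1 _).trans (mul_le_mul_of_nonneg_left hGR hq1.le)
    have n3 : ‖G * (R - 1)‖ ≤ (q - 1) * ‖G‖ := (hRw.sub_one_symm hq).norm_mul_le' hq1 _
    rw [e]
    refine (norm_add₃_le.trans (add_le_add (add_le_add n1 n2) n3)).trans (le_of_eq ?_)
    ring
  have hΦn : √κ * ‖Φ (Z - Z')‖ ≤ (q ^ 3 - lam) * ‖G‖ := by
    have e : Φ (Z - Z') = Φ G + Φ E := by rw [← map_add, hE]; congr 1; abel
    calc √κ * ‖Φ (Z - Z')‖ ≤ √κ * (‖Φ G‖ + ‖Φ E‖) := by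
          rw [e]; exact mul_le_mul_of_nonneg_left (norm_add_le _ _) (Real.sqrt_nonneg _)
      _ = √κ * ‖Φ G‖ + √κ * ‖Φ E‖ := mul_add _ _ _
      _ ≤ (1 - lam) * ‖G‖ + (q ^ 3 - 1) * ‖G‖ :=
          add_le_add (hexp G hGh hGt) ((hne E hEh).trans hEn)
      _ = _ := by ring
  have hHn : ‖H' - H‖ ≤ q * (q * ‖Φ (Z - Z')‖) := by
    rw [hHH]
    exact ((hHw.symm hq).norm_mul_le' hq0 _).trans
      (mul_le_mul_of_nonneg_left ((hHw'.symm hq).norm_mul_le hq0 _) hq0.le)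
  have hΨn : ‖Ψ (H' - H)‖ ≤ √κ * ‖H' - H‖ :=
    h.norm_map_le hne (hHw'.isHermitian.sub hHw.isHermitian)
  rw [hG']
  -- The factor `q⁴` collects the two `R'` together with `H` and `H'`; the `√κ` from `Ψ` is the one
  -- needed beside `Φ`.
  calc ‖R' * Ψ (H' - H) * R'‖ ≤ q * (q * ‖Ψ (H' - H)‖) :=
        ((hRw'.symm hq).norm_mul_le' hq0 _).trans
          (mul_le_mul_of_nonneg_left ((hRw'.symm hq).norm_mul_le hq0 _) hq0.le)
    _ ≤ q * (q * (√κ * (q * (q * ‖Φ (Z - Z')‖)))) := by gcongr; exact hΨn.trans (by gcongr)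
    _ = q ^ 4 * (√κ * ‖Φ (Z - Z')‖) := by ring
    _ ≤ q ^ 4 * ((q ^ 3 - lam) * ‖G‖) := by gcongr
    _ = _ := by ring

end IsUnitalPair

end UnitalPair

/-! ### A small gradient confines the spectrum of `Z`. -/

section Localization

open scoped Matrix.Norms.Frobenius

variable {p n : ℕ} {κ : ℝ} {Φ : Matrix (Fin p) (Fin p) ℂ →ₗ[ℂ] Matrix (Fin n) (Fin n) ℂ}
  {Ψ : Matrix (Fin n) (Fin n) ℂ →ₗ[ℂ] Matrix (Fin p) (Fin p) ℂ}

theorem isHermitian_sum_smul {m : ℕ} {P : Fin m → Matrix (Fin p) (Fin p) ℂ}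
    (hP : ∀ i, (P i).IsHermitian) (x : Fin m → ℝ) : (∑ i, x i • P i).IsHermitian := by
  simp only [Matrix.IsHermitian, Matrix.conjTranspose_sum, Matrix.conjTranspose_smul,
    (hP _).eq, star_trivial]

theorem trace_sum_smul_re {P : Fin p → Matrix (Fin p) (Fin p) ℂ}
    (hP : ∀ i, (P i).trace = 1) (x : Fin p → ℝ) : (∑ i, x i • P i).trace.re = ∑ i, x i := by
  simp [Matrix.trace_sum, Matrix.trace_smul, hP]

open scoped MatrixOrder in
/-- By geodesic convexity, a small gradient forces `Z` to be close to a multiple of the identity. -/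
theorem IsUnitalPair.exists_opWithin_of_norm_gradient_lt (h : IsUnitalPair κ Φ Ψ) {lam : ℝ}
    (h0 : 0 ≤ lam) (h1 : lam ≤ 1)
    (hexp : ∀ X : Matrix (Fin p) (Fin p) ℂ, X.IsHermitian → X.trace = 0 →
      √κ * ‖Φ X‖ ≤ (1 - lam) * ‖X‖) {d : ℝ} (hd : 0 < d)
    {Z : Matrix (Fin p) (Fin p) ℂ} (hZ : Z.PosDef)
    (hG : ‖CFC.sqrt Z * Ψ (Φ Z)⁻¹ * CFC.sqrt Z - 1‖ < d * lam * Real.exp (-(2 * d))) :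
    ∃ μ : ℝ, 0 < μ ∧ OpWithin (Real.exp d)⁻¹ (Real.exp d) (μ • Z) := by
  have hp : (0 : ℝ) < p := by exact_mod_cast h.dim_pos
  obtain ⟨P, hZP, hP1, hPpos, hPtr, hPP⟩ := hZ.isHermitian.exists_spectral_projections
  have hz : ∀ i, 0 < hZ.isHermitian.eigenvalues i := hZ.eigenvalues_pos
  set z := hZ.isHermitian.eigenvalues
  -- Subtracting the mean of the logarithms makes `W` traceless; `μ = e^{-r}` then scales `Z` to
  -- `e^W`.
  set r : ℝ := (∑ i, Real.log (z i)) / p with hr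
  set w : Fin p → ℝ := fun i => Real.log (z i) - r with hw
  have hw0 : ∑ i, w i = 0 := by
    simp only [hw, Finset.sum_sub_distrib, Finset.sum_const, Finset.card_univ, Fintype.card_fin,
      nsmul_eq_mul, hr]
    field_simp
    ring
  have hzw : ∀ i, z i = Real.exp r * Real.exp (w i) := fun i => by
    rw [← Real.exp_add, hw, add_sub_cancel, Real.exp_log (hz i)]
  refine ⟨(Real.exp r)⁻¹, by positivity, ?_⟩
  have hZe : (Real.exp r)⁻¹ • Z = ∑ i, Real.exp (w i) • P i := by
    rw [hZP, Finset.smul_sum]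
    refine Finset.sum_congr rfl fun i _ => ?_
    rw [smul_smul, hzw, inv_mul_cancel_left₀ (Real.exp_pos r).ne']
  suffices hwd : ∀ i, |w i| ≤ d by
    rw [hZe, ← Real.exp_neg]
    exact OpWithin.sum_smul hPpos hP1 (fun i => Real.exp_le_exp.2 (abs_le.1 (hwd i)).1)
      (fun i => Real.exp_le_exp.2 (abs_le.1 (hwd i)).2)
  by_contra! hcon
  obtain ⟨i₀, hi₀⟩ := hcon
  have hPh : ∀ i, (P i).IsHermitian := fun i => (hPpos i).1
  set W := ∑ i, w i • P i with hW
  have hWh : W.IsHermitian := isHermitian_sum_smul hPh w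
  have hWt : W.trace.re = 0 := by rw [hW, trace_sum_smul_re hPtr, hw0]
  have hWn : ‖W‖ ^ 2 = ∑ i, w i ^ 2 := by
    rw [← trace_mul_self_re hWh, hW, sum_smul_mul_sum_smul hPP, trace_sum_smul_re hPtr]
    simp only [pow_two]
  have hwW : ∀ i, |w i| ≤ ‖W‖ := fun i => by
    refine abs_le_of_sq_le_sq ?_ (norm_nonneg _)
    rw [hWn]
    exact Finset.single_le_sum (f := fun i => w i ^ 2) (fun _ _ => sq_nonneg _) (Finset.mem_univ i)
  have hdW : d < ‖W‖ := hi₀.trans_le (hwW i₀)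
  have hWpos : 0 < ‖W‖ := hd.trans hdW
  -- the images of the spectral projections
  set B : Fin p → Matrix (Fin n) (Fin n) ℂ := fun i => Φ (P i) with hB
  have hBpos : ∀ i, (B i).PosSemidef := fun i => h.map_posSemidef _ (hPpos i)
  have hBsum : ∀ x : Fin p → ℝ, ∑ i, x i • B i = Φ (∑ i, x i • P i) := fun x => by
    simp only [map_sum, map_real_smul, hB]
  have hB1 : ∑ i, B i = 1 := by rw [← h.map_one, ← hP1, map_sum]
  -- `t₀ = d/‖W‖` is below `1` because `‖W‖ > d`, and `|wᵢ| ≤ ‖W‖` keeps `t₀wᵢ` in `[-d, d]`.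
  have hlow := logDetSlope_lower hBpos hB1 w (t₀ := d / ‖W‖) (d := d) (by positivity)
    ((div_le_one hWpos).2 hdW.le) (fun i => by
      rw [abs_mul, abs_of_pos (by positivity), div_mul_eq_mul_div, div_le_iff₀ hWpos]
      exact mul_le_mul_of_nonneg_left (hwW i) hd.le)
  rw [hBsum, hBsum, ← hW] at hlow
  have t1 : κ * (Φ W).trace.re = 0 := by rw [h.trace_map hWh, hWt]
  have t2 : κ * (Φ (∑ i, w i ^ 2 • P i)).trace.re = ‖W‖ ^ 2 := by
    rw [h.trace_map (isHermitian_sum_smul hPh fun i => w i ^ 2),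
      trace_sum_smul_re hPtr, hWn]
  -- `(1 - λ)² ≤ 1 - λ` on `[0, 1]`, so the variance at the identity is at least `λ‖W‖²`.
  have t3 : κ * (Φ W * Φ W).trace.re ≤ (1 - lam) * ‖W‖ ^ 2 := by
    rw [trace_mul_self_re (h.map_isHermitian _ hWh)]
    have := pow_le_pow_left₀ (by positivity)
      (hexp W hWh (by rw [trace_eq_re hWh, hWt, Complex.ofReal_zero])) 2
    rw [mul_pow, Real.sq_sqrt h.pos.le, mul_pow] at this
    refine this.trans (mul_le_mul_of_nonneg_right ?_ (by positivity))
    nlinarith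
  have hlow2 : d * lam * Real.exp (-(2 * d)) * ‖W‖ ≤ κ * logDetSlope B w 1 := by
    have h3 := mul_le_mul_of_nonneg_left hlow h.pos.le
    have h4 : lam * ‖W‖ ^ 2 ≤ κ * ((Φ (∑ i, w i ^ 2 • P i)).trace.re - (Φ W * Φ W).trace.re) := by
      rw [mul_sub, t2]; linarith
    have h5 : d / ‖W‖ * (Real.exp (-(2 * d)) * (lam * ‖W‖ ^ 2)) ≤ d / ‖W‖ *
        (Real.exp (-(2 * d)) *
          (κ * ((Φ (∑ i, w i ^ 2 • P i)).trace.re - (Φ W * Φ W).trace.re))) := by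
      gcongr
    have h6 : d / ‖W‖ * (Real.exp (-(2 * d)) * (lam * ‖W‖ ^ 2)) =
        d * lam * Real.exp (-(2 * d)) * ‖W‖ := by
      field_simp
    rw [mul_add, t1] at h3
    linarith
  -- the slope is the pairing of the gradient with `W`
  set S := CFC.sqrt Z with hS
  have hSP : S = ∑ i, √(z i) • P i := by
    have hpos := posSemidef_sum_smul hPpos (fun i => Real.sqrt_nonneg (z i))
    refine CFC.sqrt_unique ?_ (Matrix.nonneg_iff_posSemidef.2 hpos)
    rw [sum_smul_mul_sum_smul hPP, hZP]
    simp only [Real.mul_self_sqrt (hz _).le]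
  have hSWS : S * W * S = ∑ i, (z i * w i) • P i := by
    rw [hSP, hW, sum_smul_mul_sum_smul hPP, sum_smul_mul_sum_smul hPP]
    refine Finset.sum_congr rfl fun i _ => ?_
    rw [mul_right_comm, Real.mul_self_sqrt (hz i).le]
  have hSWSh : (S * W * S).IsHermitian := hSWS ▸ isHermitian_sum_smul hPh _
  have hΦZ : (Φ Z).PosDef := h.map_posDef hZ
  have hYh := h.map_isHermitian' _ hΦZ.inv.isHermitian
  have hslope : κ * logDetSlope B w 1 = ((S * Ψ (Φ Z)⁻¹ * S - 1) * W).trace.re := by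
    have e1 : logDetSlope B w 1 = ((Φ Z)⁻¹ * Φ (S * W * S)).trace.re := by
      have a1 : ∑ i, Real.exp (1 * w i) • B i = (Real.exp r)⁻¹ • Φ Z := by
        simp only [one_mul]
        rw [hBsum, ← hZe, map_real_smul]
      have a2 : ∑ i, (Real.exp (1 * w i) * w i) • B i = (Real.exp r)⁻¹ • Φ (S * W * S) := by
        rw [hBsum, hSWS, ← map_real_smul, Finset.smul_sum]
        congr 1
        refine Finset.sum_congr rfl fun i _ => ?_
        rw [smul_smul, one_mul, hzw, mul_assoc, inv_mul_cancel_left₀ (Real.exp_pos r).ne']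
      rw [logDetSlope, a1, a2]
      have a3 : ((Real.exp r)⁻¹ • Φ Z)⁻¹ = Real.exp r • (Φ Z)⁻¹ := by
        rw [inv_real_smul (inv_ne_zero (Real.exp_pos r).ne') hΦZ, inv_inv]
      rw [a3, Matrix.smul_mul, Matrix.mul_smul, smul_smul, mul_inv_cancel₀ (Real.exp_pos r).ne',
        one_smul]
    rw [e1, Matrix.trace_mul_comm, h.adjoint _ _ hSWSh hΦZ.inv.isHermitian, sub_mul, one_mul,
      Matrix.trace_sub, Complex.sub_re, hWt, sub_zero, Matrix.trace_mul_comm]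
    congr 1
    rw [← Matrix.mul_assoc, Matrix.trace_mul_comm, ← Matrix.mul_assoc, ← Matrix.mul_assoc]
  have hGh : (S * Ψ (Φ Z)⁻¹ * S - 1).IsHermitian := by
    refine Matrix.IsHermitian.sub ?_ Matrix.isHermitian_one
    have hSh : S.IsHermitian := hSP ▸ isHermitian_sum_smul hPh _
    have := Matrix.isHermitian_conjTranspose_mul_mul S hYh
    rwa [hSh.eq] at this
  -- Cauchy–Schwarz gives `dλe^{-2d}‖W‖ ≤ ‖G‖‖W‖` for the gradient `G`; cancelling `‖W‖` contradicts
  -- `hG`.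
  have hfin := trace_mul_re_le _ _ hGh hWh
  rw [← hslope] at hfin
  exact absurd (le_of_mul_le_mul_right (hlow2.trans hfin) hWpos) (not_le.2 hG)

end Localization

/-! ### Choice of constants and induction over Sinkhorn steps. -/

section Iteration

open scoped Matrix.Norms.Frobenius MatrixOrder

variable {p n : ℕ} {κ : ℝ} {Φ : Matrix (Fin p) (Fin p) ℂ →ₗ[ℂ] Matrix (Fin n) (Fin n) ℂ}
  {Ψ : Matrix (Fin n) (Fin n) ℂ →ₗ[ℂ] Matrix (Fin p) (Fin p) ℂ}

theorem posDef_sqrt {m : ℕ} {Z : Matrix (Fin m) (Fin m) ℂ} (hZ : Z.PosDef) :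
    (CFC.sqrt Z).PosDef :=
  Matrix.isStrictlyPositive_iff_posDef.1
    (IsStrictlyPositive.sqrt Z (Matrix.isStrictlyPositive_iff_posDef.2 hZ))

theorem sqrt_mul_sqrt_of_posDef {m : ℕ} {Z : Matrix (Fin m) (Fin m) ℂ} (hZ : Z.PosDef) :
    CFC.sqrt Z * CFC.sqrt Z = Z :=
  CFC.sqrt_mul_sqrt_self Z (Matrix.nonneg_iff_posSemidef.2 hZ.posSemidef)

/-- The geodesic gradient of the normalised problem. -/
noncomputable def normalizedGradient
    (Φ : Matrix (Fin p) (Fin p) ℂ →ₗ[ℂ] Matrix (Fin n) (Fin n) ℂ)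
    (Ψ : Matrix (Fin n) (Fin n) ℂ →ₗ[ℂ] Matrix (Fin p) (Fin p) ℂ)
    (Z : Matrix (Fin p) (Fin p) ℂ) : Matrix (Fin p) (Fin p) ℂ :=
  CFC.sqrt Z * Ψ (Φ Z)⁻¹ * CFC.sqrt Z - 1

/-- The Sinkhorn step of the normalised problem. -/
noncomputable def normalizedStep
    (Φ : Matrix (Fin p) (Fin p) ℂ →ₗ[ℂ] Matrix (Fin n) (Fin n) ℂ)
    (Ψ : Matrix (Fin n) (Fin n) ℂ →ₗ[ℂ] Matrix (Fin p) (Fin p) ℂ)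
    (Z : Matrix (Fin p) (Fin p) ℂ) : Matrix (Fin p) (Fin p) ℂ := (Ψ (Φ Z)⁻¹)⁻¹

/-- Serves the case `λ = 0`, where the threshold forces a zero gradient and the strict localization
bound is unavailable. -/
theorem normalizedStep_eq_self {Z : Matrix (Fin p) (Fin p) ℂ}
    (hZ : Z.PosDef) (h0 : normalizedGradient Φ Ψ Z = 0) : normalizedStep Φ Ψ Z = Z := by
  have hu := (Matrix.isUnit_iff_isUnit_det _).1 (posDef_sqrt hZ).isUnit
  have h1 : CFC.sqrt Z * (Ψ (Φ Z)⁻¹ * CFC.sqrt Z) = 1 := by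
    rw [← Matrix.mul_assoc]; exact sub_eq_zero.1 h0
  have h2 : Ψ (Φ Z)⁻¹ * CFC.sqrt Z * CFC.sqrt Z = 1 := mul_eq_one_comm.1 h1
  rw [Matrix.mul_assoc, sqrt_mul_sqrt_of_posDef hZ] at h2
  exact Matrix.inv_eq_right_inv h2

namespace IsUnitalPair

theorem posDef_normalizedStep (h : IsUnitalPair κ Φ Ψ) {Z : Matrix (Fin p) (Fin p) ℂ}
    (hZ : Z.PosDef) : (normalizedStep Φ Ψ Z).PosDef :=
  (h.map_posDef' (h.map_posDef hZ).inv).inv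

theorem isHermitian_normalizedGradient (h : IsUnitalPair κ Φ Ψ) {Z : Matrix (Fin p) (Fin p) ℂ}
    (hZ : Z.PosDef) : (normalizedGradient Φ Ψ Z).IsHermitian := by
  refine Matrix.IsHermitian.sub ?_ Matrix.isHermitian_one
  have := Matrix.isHermitian_conjTranspose_mul_mul (CFC.sqrt Z)
    (h.map_posDef' (h.map_posDef hZ).inv).isHermitian
  rwa [(posDef_sqrt hZ).isHermitian.eq] at this

theorem trace_normalizedGradient (h : IsUnitalPair κ Φ Ψ) {Z : Matrix (Fin p) (Fin p) ℂ}
    (hZ : Z.PosDef) : (normalizedGradient Φ Ψ Z).trace = 0 := by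
  rw [trace_eq_re (h.isHermitian_normalizedGradient hZ), normalizedGradient,
    h.trace_gradient hZ.isHermitian (h.map_posDef hZ) (sqrt_mul_sqrt_of_posDef hZ),
    Complex.ofReal_zero]

theorem norm_normalizedGradient_step_le (h : IsUnitalPair κ Φ Ψ) {lam : ℝ} (h0 : 0 ≤ lam)
    (h1 : lam ≤ 1)
    (hexp : ∀ X : Matrix (Fin p) (Fin p) ℂ, X.IsHermitian → X.trace = 0 →
      √κ * ‖Φ X‖ ≤ (1 - lam) * ‖X‖) {Z : Matrix (Fin p) (Fin p) ℂ} (hZ : Z.PosDef)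
    (hG : ‖normalizedGradient Φ Ψ Z‖ ≤ 1 / 200 * lam ^ 2) :
    ‖normalizedGradient Φ Ψ (normalizedStep Φ Ψ Z)‖ ≤
      Real.exp (-(1 / 2 * lam)) * ‖normalizedGradient Φ Ψ Z‖ := by
  rcases h0.eq_or_lt with rfl | hlam
  · have : normalizedGradient Φ Ψ Z = 0 := norm_le_zero_iff.1 (by simpa using hG)
    rw [normalizedStep_eq_self hZ this, this]
    simp
  -- With `d = λ/80` and `e^{-λ/40} ≥ 1/2`, the localization threshold is at least `λ²/160`, above
  -- `λ²/200`.
  have hlt : ‖normalizedGradient Φ Ψ Z‖ < lam / 80 * lam * Real.exp (-(2 * (lam / 80))) := by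
    have := Real.add_one_le_exp (-(2 * (lam / 80)))
    have h2 : (1 : ℝ) / 2 ≤ Real.exp (-(2 * (lam / 80))) := by linarith
    have h3 := mul_le_mul_of_nonneg_left h2 (show 0 ≤ lam / 80 * lam by positivity)
    nlinarith [sq_pos_of_pos hlam]
  obtain ⟨μ, hμ, hw⟩ := h.exists_opWithin_of_norm_gradient_lt h0 h1 hexp (by positivity) hZ hlt
  set q := Real.exp (lam / 80) with hq
  have hq1 : 1 < q := Real.one_lt_exp_iff.2 (by positivity)
  have hZ' := h.posDef_normalizedStep hZ
  set Z' := normalizedStep Φ Ψ Z with hZ'def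
  have hsq : √μ * √μ = μ := Real.mul_self_sqrt hμ.le
  have hsqrt : ∀ {X : Matrix (Fin p) (Fin p) ℂ}, X.PosDef →
      (√μ • CFC.sqrt X) * (√μ • CFC.sqrt X) = μ • X := fun hX => by
    rw [Matrix.smul_mul, Matrix.mul_smul, smul_smul, hsq, sqrt_mul_sqrt_of_posDef hX]
  have hscale : ∀ {X : Matrix (Fin p) (Fin p) ℂ}, X.PosDef →
      Ψ (Φ (μ • X))⁻¹ = μ⁻¹ • Ψ (Φ X)⁻¹ := fun hX => by
    rw [map_real_smul, inv_real_smul hμ.ne' (h.map_posDef hX), map_real_smul]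
  -- The gradient is invariant under `X ↦ μX`. The root `√μ √X` is used for `μX`, which is why
  -- `norm_gradient_step_le` accepts any positive definite root.
  have hgrad : ∀ {X : Matrix (Fin p) (Fin p) ℂ}, X.PosDef →
      (√μ • CFC.sqrt X) * Ψ (Φ (μ • X))⁻¹ * (√μ • CFC.sqrt X) - 1 =
        normalizedGradient Φ Ψ X := fun hX => by
    rw [hscale hX, normalizedGradient]
    simp only [Matrix.smul_mul, Matrix.mul_smul, smul_smul]
    rw [mul_left_comm, hsq, inv_mul_cancel₀ hμ.ne', one_smul]
  have hstep := h.norm_gradient_step_le h0 hexp hq1 hw (Z' := μ • Z')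
    (R := √μ • CFC.sqrt Z) (R' := √μ • CFC.sqrt Z')
    (by rw [hscale hZ, inv_real_smul (inv_ne_zero hμ.ne') (h.map_posDef' (h.map_posDef hZ).inv),
      inv_inv]; rfl)
    (posDef_real_smul (posDef_sqrt hZ) (Real.sqrt_pos.2 hμ)) (hsqrt hZ)
    (posDef_real_smul (posDef_sqrt hZ') (Real.sqrt_pos.2 hμ)) (hsqrt hZ')
  rw [hgrad hZ, hgrad hZ'] at hstep
  refine hstep.trans (mul_le_mul_of_nonneg_right ?_ (norm_nonneg _))
  have hx : q ≤ 1 + lam / 40 := by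
    have := Real.abs_exp_sub_one_le (x := lam / 80) (by rw [abs_of_pos (by positivity)]; linarith)
    rw [abs_of_pos (by positivity : 0 < lam / 80)] at this
    linarith [(abs_le.1 this).2]
  have hq3 : q ^ 3 ≤ 1 + lam / 10 := by
    refine (pow_le_pow_left₀ (by positivity) hx 3).trans ?_
    nlinarith [mul_nonneg h0 h0, mul_nonneg h0 (mul_nonneg h0 h0)]
  have hq4 : q ^ 4 ≤ 1 + lam / 5 := by
    have : q ^ 4 = q ^ 3 * q := by ring
    rw [this]
    refine (mul_le_mul hq3 hx (by positivity) (by positivity)).trans ?_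
    nlinarith
  -- `(1 + λ/5)(1 - 9λ/10) ≤ 1 - λ/2 ≤ e^{-λ/2}`.
  have hprod : q ^ 4 * (q ^ 3 - lam) ≤ (1 + lam / 5) * (1 + lam / 10 - lam) :=
    (mul_le_mul_of_nonneg_left (by linarith) (by positivity)).trans
      (mul_le_mul_of_nonneg_right hq4 (by linarith))
  have := Real.add_one_le_exp (-(1 / 2 * lam))
  nlinarith [mul_nonneg h0 h0]

theorem norm_normalizedGradient_iterate_le (h : IsUnitalPair κ Φ Ψ) {lam : ℝ} (h0 : 0 ≤ lam)
    (hexp : ∀ X : Matrix (Fin p) (Fin p) ℂ, X.IsHermitian → X.trace = 0 →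
      √κ * ‖Φ X‖ ≤ (1 - lam) * ‖X‖) {Z : Matrix (Fin p) (Fin p) ℂ} (hZ : Z.PosDef)
    (hG : ‖normalizedGradient Φ Ψ Z‖ ≤ 1 / 200 * lam ^ 2) (T : ℕ) :
    ((normalizedStep Φ Ψ)^[T] Z).PosDef ∧
      ‖normalizedGradient Φ Ψ ((normalizedStep Φ Ψ)^[T] Z)‖ ≤ Real.exp (-(1 / 2 * lam * T)) := by
  have hpos : ∀ T : ℕ, ((normalizedStep Φ Ψ)^[T] Z).PosDef := fun T => by
    induction T with
    | zero => exact hZ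
    | succ T ih => rw [Function.iterate_succ_apply']; exact h.posDef_normalizedStep ih
  refine ⟨hpos T, ?_⟩
  rcases le_or_gt lam 1 with h1 | h1
  -- Keeping the factor `λ²/200` in the induction ensures that each iterate meets the hypothesis of
  -- the one-step bound; it is at most `1` and is dropped at the end.
  · have key : ‖normalizedGradient Φ Ψ ((normalizedStep Φ Ψ)^[T] Z)‖ ≤
        Real.exp (-(1 / 2 * lam * T)) * (1 / 200 * lam ^ 2) := by
      induction T with
      | zero => simpa using hG
      | succ T ih =>
        have hle : Real.exp (-(1 / 2 * lam * T)) ≤ 1 :=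
          Real.exp_le_one_iff.2 (neg_nonpos.2 (by positivity))
        rw [Function.iterate_succ_apply']
        refine (h.norm_normalizedGradient_step_le h0 h1 hexp (hpos T)
          (ih.trans (mul_le_of_le_one_left (by positivity) hle))).trans ?_
        refine (mul_le_mul_of_nonneg_left ih (Real.exp_pos _).le).trans (le_of_eq ?_)
        rw [← mul_assoc, ← Real.exp_add]
        congr 2
        push_cast
        ring
    refine key.trans (mul_le_of_le_one_right (Real.exp_pos _).le ?_)
    nlinarith
  -- For `λ > 1` the expander bound has a negative factor, so every traceless Hermitian matrix, in
  -- particular the gradient, vanishes.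
  · have hgz : ‖normalizedGradient Φ Ψ ((normalizedStep Φ Ψ)^[T] Z)‖ ≤ 0 := by
      have h2 := hexp _ (h.isHermitian_normalizedGradient (hpos T))
        (h.trace_normalizedGradient (hpos T))
      have h3 : 0 ≤ (1 - lam) * ‖normalizedGradient Φ Ψ ((normalizedStep Φ Ψ)^[T] Z)‖ :=
        le_trans (by positivity) h2
      by_contra! h4
      nlinarith
    exact hgz.trans (Real.exp_pos _).le

end IsUnitalPair

end Iteration

/-! ### Rescaling a quantum expander to a unital pair. -/

section Normalization

open scoped Matrix.Norms.Frobenius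

variable {p n : ℕ} {Φ : Matrix (Fin p) (Fin p) ℂ →ₗ[ℂ] Matrix (Fin n) (Fin n) ℂ}

theorem eq_of_opNorm_sub_le_zero {m : ℕ} {A B : Matrix (Fin m) (Fin m) ℂ}
    (h : opNorm (A - B) ≤ 0) : A = B := by
  have h1 := norm_le_zero_iff.1 h
  exact sub_eq_zero.1 ((map_eq_zero_iff _ (EquivLike.injective _)).1 h1)

/-- The size is `∑ₖ ‖Aₖ‖²` in Frobenius norms, so it vanishes only if every Kraus operator does. -/
theorem IsCompletelyPositive.size_pos (hΦ : IsCompletelyPositive Φ) (h0 : Φ ≠ 0) :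
    0 < size Φ := by
  obtain ⟨r, A, hA⟩ := hΦ
  have hs : size Φ = ∑ k, ‖(A k)ᴴ‖ ^ 2 := by
    rw [size, hA, Matrix.trace_sum, Complex.re_sum]
    refine Finset.sum_congr rfl fun k _ => ?_
    rw [← frobenius_sq_rect, Matrix.conjTranspose_conjTranspose, Matrix.mul_one]
  rw [hs]
  refine lt_of_le_of_ne (by positivity) fun h => h0 (LinearMap.ext fun X => ?_)
  have h1 := (Finset.sum_eq_zero_iff_of_nonneg fun k _ => by positivity).1 h.symm
  rw [hA]
  refine Finset.sum_eq_zero fun k hk => ?_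
  have h2 : (A k)ᴴ = 0 := norm_eq_zero.1 (pow_eq_zero_iff two_ne_zero |>.1 (h1 k hk))
  rw [h2, Matrix.mul_zero]

theorem isUnitalPair_of_isQuantumExpander {q : ℝ} (h0 : Φ ≠ 0) (hΦ : IsQuantumExpander Φ q) :
    IsUnitalPair ((p : ℝ) / n) (((n / size Φ : ℝ) : ℂ) • Φ) (((p / size Φ : ℝ) : ℂ) • dual Φ) := by
  obtain ⟨hcp, ⟨hb1, hb2⟩, -⟩ := hΦ
  have hs := hcp.size_pos h0
  obtain ⟨r, A, hA⟩ := hcp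
  have hdual := dual_eq_of_kraus Φ A hA
  have hp : 0 < p := Nat.pos_of_ne_zero fun hp => h0 (by subst hp; exact Subsingleton.elim _ _)
  have hn : 0 < n := Nat.pos_of_ne_zero fun hn => h0 (by
    subst hn; exact LinearMap.ext fun X => Subsingleton.elim _ _)
  have hp' : (0 : ℝ) < p := by exact_mod_cast hp
  have hn' : (0 : ℝ) < n := by exact_mod_cast hn
  have e1 : Φ 1 = (size Φ / n) • (1 : Matrix (Fin n) (Fin n) ℂ) :=
    eq_of_opNorm_sub_le_zero (by simpa using hb1)
  have e2 : dual Φ 1 = (size Φ / p) • (1 : Matrix (Fin p) (Fin p) ℂ) :=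
    eq_of_opNorm_sub_le_zero (by simpa using hb2)
  have herm : ∀ X : Matrix (Fin p) (Fin p) ℂ, X.IsHermitian → (Φ X).IsHermitian := fun X hX => by
    simp only [hA, Matrix.IsHermitian, Matrix.conjTranspose_sum, Matrix.conjTranspose_mul,
      Matrix.conjTranspose_conjTranspose, hX.eq, Matrix.mul_assoc]
  have herm' : ∀ Y : Matrix (Fin n) (Fin n) ℂ, Y.IsHermitian → (dual Φ Y).IsHermitian :=
    fun Y hY => by
      simp only [hdual, Matrix.IsHermitian, Matrix.conjTranspose_sum, Matrix.conjTranspose_mul,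
        Matrix.conjTranspose_conjTranspose, hY.eq, Matrix.mul_assoc]
  refine ⟨by positivity, hp, fun X hX => ?_, fun Y hY => ?_, fun X hX => ?_, fun Y hY => ?_, ?_, ?_,
    fun X Y hX hY => ?_⟩
  · rw [LinearMap.smul_apply, Complex.coe_smul, hA]
    exact posSemidef_real_smul (Matrix.posSemidef_sum _ fun k _ =>
      hX.mul_mul_conjTranspose_same _) (by positivity)
  · rw [LinearMap.smul_apply, Complex.coe_smul, hdual]
    exact posSemidef_real_smul (Matrix.posSemidef_sum _ fun k _ =>
      hY.conjTranspose_mul_mul_same _) (by positivity)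
  · rw [LinearMap.smul_apply, Complex.coe_smul]
    exact isHermitian_real_smul (herm X hX) _
  · rw [LinearMap.smul_apply, Complex.coe_smul]
    exact isHermitian_real_smul (herm' Y hY) _
  · rw [LinearMap.smul_apply, Complex.coe_smul, e1, smul_smul,
      div_mul_div_cancel₀ hs.ne', div_self hn'.ne', one_smul]
  · rw [LinearMap.smul_apply, Complex.coe_smul, e2, smul_smul,
      div_mul_div_cancel₀ hs.ne', div_self hp'.ne', one_smul]
  · have h1 := trace_dual Φ X Y
    rw [(herm X hX).eq, hX.eq] at h1
    simp only [LinearMap.smul_apply, Complex.coe_smul, Matrix.smul_mul, Matrix.mul_smul,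
      Matrix.trace_smul, Complex.smul_re, h1, smul_eq_mul]
    field_simp

theorem norm_le_of_isQuantumExpander {q : ℝ} (h0 : Φ ≠ 0) (hΦ : IsQuantumExpander Φ q)
    (X : Matrix (Fin p) (Fin p) ℂ) (hX : X.IsHermitian) (hX0 : X.trace = 0) :
    √((p : ℝ) / n) * ‖(((n / size Φ : ℝ) : ℂ) • Φ) X‖ ≤ q * ‖X‖ := by
  have hpair := isUnitalPair_of_isQuantumExpander h0 hΦ
  have hs := hΦ.1.size_pos h0
  have hp : (0 : ℝ) < p := by exact_mod_cast hpair.dim_pos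
  have hn : (0 : ℝ) < n := by
    have := hpair.pos
    by_contra hn
    rw [le_antisymm (not_lt.1 hn) (Nat.cast_nonneg n), div_zero] at this
    exact lt_irrefl _ this
  have h1 := hΦ.2.2 X hX hX0
  rw [LinearMap.smul_apply, norm_smul, Complex.norm_real, Real.norm_of_nonneg (by positivity)]
  -- The normalisation `s/√(np)` in the expander bound is exactly what turns into `√κ` after
  -- rescaling.
  have h2 : √((p : ℝ) / n) * (n / size Φ) * (size Φ / √(n * p)) = 1 := by
    rw [Real.sqrt_div hp.le, Real.sqrt_mul hn.le]
    have a1 : √(n : ℝ) * √n = n := Real.mul_self_sqrt hn.le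
    have a2 := Real.sqrt_pos.2 hp
    have a3 := Real.sqrt_pos.2 hn
    field_simp
    rw [pow_two, a1]
  calc √((p : ℝ) / n) * (n / size Φ * ‖Φ X‖)
      ≤ √((p : ℝ) / n) * (n / size Φ * (q * (size Φ / √(n * p)) * ‖X‖)) := by gcongr
    _ = √((p : ℝ) / n) * (n / size Φ) * (size Φ / √(n * p)) * (q * ‖X‖) := by ring
    _ = q * ‖X‖ := by rw [h2, one_mul]

end Normalization

end OperatorScaling

/-! ### Transfer to the original map. -/

open OperatorScaling in
open scoped Matrix.Norms.Frobenius in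
theorem sinkhorn_convergence_of_isQuantumExpander {p n : ℕ}
    {Φ : Matrix (Fin p) (Fin p) ℂ →ₗ[ℂ] Matrix (Fin n) (Fin n) ℂ} {lam : ℝ}
    {Z₀ : Matrix (Fin p) (Fin p) ℂ} (h0 : Φ ≠ 0) (hlam : 0 ≤ lam)
    (hΦ : IsQuantumExpander Φ (1 - lam)) (hZ₀ : Z₀.PosDef)
    (hG : ‖geodesicGradient (capacityFun Φ) Z₀‖ ≤ 1 / 200 * lam ^ 2) (T : ℕ) :
    (sinkhorn Φ Z₀ T).PosDef ∧
      GeodesicallyDifferentiableAt (capacityFun Φ) (sinkhorn Φ Z₀ T) ∧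
      ‖geodesicGradient (capacityFun Φ) (sinkhorn Φ Z₀ T)‖ ≤ Real.exp (-(1 / 2 * lam * T)) := by
  have hpair := isUnitalPair_of_isQuantumExpander h0 hΦ
  have hexp := norm_le_of_isQuantumExpander h0 hΦ
  have hs := hΦ.1.size_pos h0
  set s := size Φ
  have hp : (0 : ℝ) < p := by exact_mod_cast hpair.dim_pos
  have hn : (n : ℝ) ≠ 0 := fun hn => by
    have := hpair.pos
    rw [hn, div_zero] at this
    exact lt_irrefl _ this
  set Φ' := ((n / s : ℝ) : ℂ) • Φ with hΦ'
  set Ψ := ((p / s : ℝ) : ℂ) • dual Φ with hΨ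
  have hΦe : ∀ X, Φ X = (s / n) • Φ' X := fun X => by
    rw [hΦ', LinearMap.smul_apply, Complex.coe_smul, smul_smul, div_mul_div_cancel₀ hn,
      div_self hs.ne', one_smul]
  have hdual : ∀ Y, dual Φ Y = (s / p) • Ψ Y := fun Y => by
    rw [hΨ, LinearMap.smul_apply, Complex.coe_smul, smul_smul, div_mul_div_cancel₀ hp.ne',
      div_self hs.ne', one_smul]
  have hsn : s / n ≠ 0 := div_ne_zero hs.ne' hn
  have hpos : ∀ {Z : Matrix (Fin p) (Fin p) ℂ}, Z.PosDef → (Φ Z).PosDef := fun hZ => by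
    rw [hΦe]
    exact posDef_real_smul (hpair.map_posDef hZ) (div_pos hs (lt_of_le_of_ne n.cast_nonneg hn.symm))
  -- The scalars cancel, `(p/n)(s/p)(n/s) = 1`, so both maps give the same Sinkhorn step and the
  -- same gradient.
  have hstep : ∀ {Z : Matrix (Fin p) (Fin p) ℂ}, Z.PosDef →
      ((p : ℝ) / n) • dual Φ (Φ Z)⁻¹ = Ψ (Φ' Z)⁻¹ := fun {Z} hZ => by
    rw [hdual, hΦe, inv_real_smul hsn (hpair.map_posDef hZ), map_real_smul, smul_smul, smul_smul]
    have : (p : ℝ) / n * (s / p * (s / n)⁻¹) = 1 := by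
      field_simp
    rw [← mul_assoc] at this
    rw [this, one_smul]
  have hgrad : ∀ {Z : Matrix (Fin p) (Fin p) ℂ}, Z.PosDef →
      GeodesicallyDifferentiableAt (capacityFun Φ) Z ∧
        ‖geodesicGradient (capacityFun Φ) Z‖ = ‖normalizedGradient Φ' Ψ Z‖ := fun {Z} hZ => by
    obtain ⟨h1, h2⟩ := geodesicGradient_capacityFun Φ
      (fun X hX => by rw [hΦe]; exact isHermitian_real_smul (hpair.map_isHermitian X hX) _)
      (fun Y hY => by rw [hdual]; exact isHermitian_real_smul (hpair.map_isHermitian' Y hY) _)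
      hZ (hpos hZ)
    refine ⟨h1, ?_⟩
    rw [Herm.norm_eq_frobenius, h2, hstep hZ, normalizedGradient]
  have hiter := hpair.norm_normalizedGradient_iterate_le hlam hexp hZ₀ ((hgrad hZ₀).2 ▸ hG)
  have hsink : ∀ T, sinkhorn Φ Z₀ T = (normalizedStep Φ' Ψ)^[T] Z₀ := fun T => by
    induction T with
    | zero => rfl
    | succ T ih =>
      rw [Function.iterate_succ_apply', ← ih, sinkhorn, hstep (ih ▸ (hiter T).1), normalizedStep]
  rw [hsink]
  exact ⟨(hiter T).1, (hgrad (hiter T).1).1, (hgrad (hiter T).1).2 ▸ (hiter T).2⟩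

theorem mainTheorem5 :
    ∃ c : ℝ, 0 < c ∧ ∃ a : ℝ, 0 < a ∧
      ∀ (p n : ℕ) (Φ : Matrix (Fin p) (Fin p) ℂ →ₗ[ℂ] Matrix (Fin n) (Fin n) ℂ)
        (lam : ℝ) (Z₀ : Matrix (Fin p) (Fin p) ℂ),
        Φ ≠ 0 → 0 ≤ lam → OperatorScaling.IsQuantumExpander Φ (1 - lam) →
        Z₀.PosDef →
        ‖OperatorScaling.geodesicGradient (OperatorScaling.capacityFun Φ) Z₀‖ ≤ c * lam ^ 2 →
        ∀ T : ℕ,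
          (OperatorScaling.sinkhorn Φ Z₀ T).PosDef ∧
          OperatorScaling.GeodesicallyDifferentiableAt (OperatorScaling.capacityFun Φ)
            (OperatorScaling.sinkhorn Φ Z₀ T) ∧
          ‖OperatorScaling.geodesicGradient (OperatorScaling.capacityFun Φ)
            (OperatorScaling.sinkhorn Φ Z₀ T)‖ ≤ Real.exp (-(a * lam * T)) :=
  ⟨1 / 200, by norm_num, 1 / 2, by norm_num, fun _ _ _ _ _ h0 hlam hΦ hZ₀ hG T =>
    sinkhorn_convergence_of_isQuantumExpander h0 hlam hΦ hZ₀ hG T⟩
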